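/- Fix an integer $p\ge 1$. For $n\in\mathbb N$ set $\alpha=p+1$, $\gamma=40\sqrt{\ln n/n}$, $k=k(n)=\lfloor(0.1/\gamma)^{2/3}\rfloor$, $\rho=\gamma/(100\,\alpha\ln n)$, $\beta=\gamma/\ln n$ and $\epsilon=0.1/\sqrt{k}$. For a $k$-tuple $V=(v_1,\dots,v_k)$ of orthonormal vectors in $\mathbb R^n$ define, for $1\le i\le k$ and $x\in\mathbb R^n$, $$f_i(x)=\rho\ln\Bigl(\sum_{\ell=1}^{i}\exp\Bigl(\frac{\langle v_\ell,x\rangle+(k-\ell)\gamma}{\rho}\Bigr)\Bigr)+\rho(k-i)n^{-\alpha},\qquad h(x)=\max_{1\le i\le k}f_i(x),$$ and $g=S_{\beta/2^{p}}[\cdots S_{\beta/2^{2}}[S_{\beta/2}[h]]\cdots]$, where $S_\eta[f](x)$ is the average of $f$ over the closed Euclidean ball of radius $\eta$ around $x$. The $p$-th order oracle of $g$ answers a query $x$ with $(g(x),\nabla g(x),\dots,\nabla^p g(x))$. A point $x$ is called $\epsilon$-optimal for $g$ if $\|x\|\le 1$ and $g(x)-\min_{\|y\|\le 1}g(y)\le\epsilon$.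 Theorem. Let $V$ be a Haar-random $k$-tuple of orthonormal vectors in $\mathbb R^n$. Consider (adaptive) randomized algorithms whose randomness is independent of $V$, whose moves depend measurably on the random seed and on the oracle answers received so far, and which query the $p$-th order oracle of $g$ at points of the closed unit ball of $\mathbb R^n$. The probability, over $V$ and the randomness of the algorithm, that such an algorithm makes at most $k-1$ queries and outputs an $\epsilon$-optimal point for $g$ is $o(1)$ as $n\to\infty$ (for fixed $p$), uniformly over all such algorithms. In fact, for every $n$ with $k(n)\ge 1$ and every such algorithm, this probability is at most $(k+1)\,n^{-10}$. -/

import Mathlib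

open MeasureTheory Filter Topology
open scoped ENNReal

noncomputable section

namespace SmoothConvexLB

/-- Euclidean space `ℝⁿ` with the `ℓ₂` norm. -/
abbrev E (n : ℕ) : Type := EuclideanSpace ℝ (Fin n)

/-! ### Parameters -/

/-- `γ = 40 √(ln n / n)`. -/
def gammaPar (n : ℕ) : ℝ := 40 * √(Real.log n / n)

/-- `k = ⌊(0.1 / γ)^{2/3}⌋`. -/
def kPar (n : ℕ) : ℕ := ⌊((0.1 : ℝ) / gammaPar n) ^ ((2 : ℝ) / 3)⌋₊

/-- `α = p + 1`. -/
def alphaPar (p : ℕ) : ℕ := p + 1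

/-- `ρ = γ / (100 α ln n)`. -/
def rhoPar (p n : ℕ) : ℝ := gammaPar n / (100 * (alphaPar p : ℝ) * Real.log n)

/-- `β = γ / ln n`. -/
def betaPar (n : ℕ) : ℝ := gammaPar n / Real.log n

/-- `ε = 0.1 / √k`. -/
def epsPar (n : ℕ) : ℝ := (0.1 : ℝ) / √(kPar n : ℝ)

/-- There are at most `n` hidden orthonormal vectors in `ℝⁿ`. -/
theorem kPar_le (n : ℕ) : kPar n ≤ n := by
  unfold kPar gammaPar
  rcases Nat.lt_or_ge n 2 with h | h
  · have h2 : n = 0 ∨ n = 1 := by omega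
    have h3 : ((2 : ℝ) / 3) ≠ 0 := by norm_num
    rcases h2 with rfl | rfl <;> simp [Real.zero_rpow h3]
  · have hn2 : (2 : ℝ) ≤ n := by exact_mod_cast h
    have hn : (0 : ℝ) < n := by linarith
    have hlog : (1 / 2 : ℝ) ≤ Real.log n := by
      have h1 := Real.log_two_gt_d9
      have h2 := Real.log_le_log (by norm_num) hn2
      linarith
    have hs : (1 : ℝ) / n ≤ √(Real.log n / n) := by
      apply Real.le_sqrt_of_sq_le
      rw [div_pow, div_le_div_iff₀ (by positivity) hn]
      nlinarith
    have hs0 : (0 : ℝ) < 1 / n := by positivity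
    have hq : (0.1 : ℝ) / (40 * √(Real.log n / n)) ≤ n := by
      rw [div_le_iff₀ (by linarith)]
      have h1 : (n : ℝ) * (1 / n) = 1 := by field_simp
      nlinarith [mul_le_mul_of_nonneg_left hs hn.le]
    have hr : ((0.1 : ℝ) / (40 * √(Real.log n / n))) ^ ((2 : ℝ) / 3) ≤ n := by
      calc ((0.1 : ℝ) / (40 * √(Real.log n / n))) ^ ((2 : ℝ) / 3)
          ≤ (n : ℝ) ^ ((2 : ℝ) / 3) :=
            Real.rpow_le_rpow (by positivity) hq (by norm_num)
        _ ≤ (n : ℝ) ^ (1 : ℝ) :=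
            Real.rpow_le_rpow_of_exponent_le (by linarith) (by norm_num)
        _ = n := Real.rpow_one _
    exact Nat.floor_le_of_le hr

/-! ### Randomized smoothing -/

/-- `S_η[f](x)` is the average of `f` over the closed ball of radius `η` around `x`. -/
def ballSmooth {n : ℕ} (η : ℝ) (f : E n → ℝ) : E n → ℝ :=
  fun x => ⨍ y in Metric.closedBall x η, f y

/-- `S_{β/2^p}[ ⋯ S_{β/2²}[S_{β/2}[f]] ⋯ ]`. -/
def smoothing {n : ℕ} (β : ℝ) : ℕ → (E n → ℝ) → (E n → ℝ)
  | 0, f => f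
  | p + 1, f => ballSmooth (β / 2 ^ (p + 1)) (smoothing β p f)

/-! ### The hard functions

The index `i : Fin k` stands for the index `i + 1` of the usual numbering `1, …, k`. -/

/-- Softmax of the first `m` coordinates: `ρ ln (∑_{i ≤ m} exp (z_i / ρ))`. -/
def smaxLE {k : ℕ} (ρ : ℝ) (m : ℕ) (z : Fin k → ℝ) : ℝ :=
  ρ * Real.log (∑ i ∈ Finset.univ.filter (fun i : Fin k => (i : ℕ) < m), Real.exp (z i / ρ))

/-- `vec_V(x) = (⟨v₁, x⟩ + (k-1)γ, ⟨v₂, x⟩ + (k-2)γ, …, ⟨v_k, x⟩)`. -/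
def vecV {n k : ℕ} (γ : ℝ) (V : Fin k → E n) (x : E n) : Fin k → ℝ :=
  fun i => inner ℝ (V i) x + ((k : ℝ) - ((i : ℝ) + 1)) * γ

/-- `f_i(x) = smax_ρ^{≤ i}(vec_V(x)) + ρ (k - i) n^{-α}`. -/
def fHard (p : ℕ) {n k : ℕ} (V : Fin k → E n) (i : Fin k) (x : E n) : ℝ :=
  smaxLE (rhoPar p n) ((i : ℕ) + 1) (vecV (gammaPar n) V x)
    + rhoPar p n * ((k : ℝ) - ((i : ℝ) + 1)) * ((n : ℝ) ^ alphaPar p)⁻¹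

/-- `h(x) = max_{1 ≤ i ≤ k} f_i(x)`. -/
def hHard (p : ℕ) {n k : ℕ} (V : Fin k → E n) (x : E n) : ℝ :=
  ⨆ i : Fin k, fHard p V i x

/-- `g = S[h]`, the smoothing of `h`. -/
def gHard (p : ℕ) {n k : ℕ} (V : Fin k → E n) : E n → ℝ :=
  smoothing (betaPar n) p (hHard p V)

/-- `x` is an `ε`-approximate minimum of `f` in the closed unit ball: it lies in the ball and
`f(x) ≤ f(y) + ε` for every point `y` of the ball. -/
def IsApproxMin {n : ℕ} (ε : ℝ) (f : E n → ℝ) (x : E n) : Prop :=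
  ‖x‖ ≤ 1 ∧ ∀ y : E n, ‖y‖ ≤ 1 → f x ≤ f y + ε

/-! ### The `p`-th order oracle -/

/-- An answer of the `p`-th order oracle: for every `i ≤ p` a tensor of order `i` on `ℝⁿ`, given
by its `n^i` coordinates. -/
abbrev Answer (n p : ℕ) : Type := (i : Fin (p + 1)) → (Fin (i : ℕ) → Fin n) → ℝ

/-- `Q_f(x) = (f(x), ∇f(x), …, ∇^p f(x))`: the coordinate of `∇^i f(x)` at `(j₁, …, j_i)` is
the iterated derivative of `f` at `x` in the directions of the basis vectors
`e_{j₁}, …, e_{j_i}`. -/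
def oracle {n : ℕ} (p : ℕ) (f : E n → ℝ) (x : E n) : Answer n p :=
  fun i J => iteratedFDeriv ℝ (i : ℕ) f x (fun l => EuclideanSpace.single (J l) (1 : ℝ))

/-! ### Haar-random orthonormal vectors -/

instance orthMeasurableSpace (n : ℕ) : MeasurableSpace (Matrix.orthogonalGroup (Fin n) ℝ) :=
  borel _

instance orthBorelSpace (n : ℕ) : BorelSpace (Matrix.orthogonalGroup (Fin n) ℝ) := ⟨rfl⟩

instance orthCompactSpace (n : ℕ) : CompactSpace (Matrix.orthogonalGroup (Fin n) ℝ) := by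
  have hK : IsCompact (Set.univ.pi fun _ : Fin n => Set.univ.pi fun _ : Fin n =>
      Metric.closedBall (0 : ℝ) 1) :=
    isCompact_univ_pi fun _ => isCompact_univ_pi fun _ => isCompact_closedBall 0 1
  have hc : IsClosed ((Matrix.orthogonalGroup (Fin n) ℝ : Set (Matrix (Fin n) (Fin n) ℝ))) := by
    have : (Matrix.orthogonalGroup (Fin n) ℝ : Set (Matrix (Fin n) (Fin n) ℝ))
        = {A | A * star A = 1} := by
      ext A
      exact Matrix.mem_orthogonalGroup_iff (Fin n) ℝ
    rw [this]
    exact isClosed_eq (by fun_prop) continuous_const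
  refine isCompact_iff_compactSpace.mp ?_
  refine IsCompact.of_isClosed_subset hK hc ?_
  intro A hA
  exact fun i _ j _ => mem_closedBall_zero_iff.mpr (entry_norm_bound_of_unitary hA i j)

/-- The normalized Haar measure of the orthogonal group `O(n)`. -/
def haarO (n : ℕ) : Measure (Matrix.orthogonalGroup (Fin n) ℝ) :=
  Measure.haarMeasure ⊤

instance haarO_prob (n : ℕ) : IsProbabilityMeasure (haarO n) :=
  ⟨Measure.haarMeasure_self
    (K₀ := (⊤ : TopologicalSpace.PositiveCompacts (Matrix.orthogonalGroup (Fin n) ℝ)))⟩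

/-- The first `k` columns of an orthogonal matrix. -/
def columns {n k : ℕ} (hk : k ≤ n) (U : Matrix.orthogonalGroup (Fin n) ℝ) : Fin k → E n :=
  fun i => WithLp.toLp 2 fun a => (U : Matrix (Fin n) (Fin n) ℝ) a (Fin.castLE hk i)

theorem continuous_columns {n k : ℕ} (hk : k ≤ n) : Continuous (columns hk) := by
  refine continuous_pi fun i => ?_
  refine (PiLp.continuous_toLp 2 _).comp (continuous_pi fun a => ?_)
  exact (continuous_subtype_val (p := (· ∈ Matrix.orthogonalGroup (Fin n) ℝ))).matrix_elem a _

/-- The law of a Haar-random `k`-tuple of orthonormal vectors in `ℝⁿ`: the first `k` columns of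
a Haar-random orthogonal matrix. -/
def haarFrame {n k : ℕ} (hk : k ≤ n) : Measure (Fin k → E n) :=
  (haarO n).map (columns hk)

instance haarFrame_prob {n k : ℕ} (hk : k ≤ n) : IsProbabilityMeasure (haarFrame hk) :=
  Measure.isProbabilityMeasure_map (continuous_columns hk).measurable.aemeasurable

/-! ### Randomized query algorithms -/

/-- A randomized (adaptive) query algorithm with random seed `ω : Ω`. After it has received `i`
answers, the seed and these answers determine its next move: either `Sum.inl x`, a query of the
point `x` of the unit ball, or `Sum.inr x`, which stops with the output `x`. There is no
restriction on its computing power beyond measurability. -/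
structure RandAlg (n p : ℕ) (Ω : Type*) [MeasurableSpace Ω] where
  next : (i : ℕ) → Ω → (Fin i → Answer n p) → E n ⊕ E n
  measurable_next : ∀ i, Measurable fun q : Ω × (Fin i → Answer n p) => next i q.1 q.2
  query_mem : ∀ i ω a x, next i ω a = Sum.inl x → ‖x‖ ≤ 1

/-- The run with seed `ω` and oracle `O` that continues from the `i` answers `a` received so far
and may make at most `m` further queries; it gives `some` output if the algorithm stops within
this budget and `none` if it asks for more queries. -/
def RandAlg.runFrom {n p : ℕ} {Ω : Type*} [MeasurableSpace Ω] (A : RandAlg n p Ω)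
    (O : E n → Answer n p) (ω : Ω) : ℕ → (i : ℕ) → (Fin i → Answer n p) → Option (E n)
  | 0, i, a =>
    match A.next i ω a with
    | Sum.inl _ => none
    | Sum.inr x => some x
  | m + 1, i, a =>
    match A.next i ω a with
    | Sum.inl x => A.runFrom O ω m (i + 1) (Fin.snoc (α := fun _ => Answer n p) a (O x))
    | Sum.inr x => some x

/-- The output of the algorithm with seed `ω` and oracle `O`, if it makes at most `m` queries. -/
def RandAlg.output {n p : ℕ} {Ω : Type*} [MeasurableSpace Ω] (A : RandAlg n p Ω)
    (O : E n → Answer n p) (m : ℕ) (ω : Ω) : Option (E n) :=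
  A.runFrom O ω m 0 Fin.elim0

/-- The probability, over the seed and an independent Haar-random `V`, that the algorithm makes
at most `k - 1` queries to the `p`-th order oracle of `g` and outputs an `ε`-optimal point. -/
def successProb {n p : ℕ} {Ω : Type*} [MeasurableSpace Ω] (μ : Measure Ω)
    (A : RandAlg n p Ω) : ℝ≥0∞ :=
  (μ.prod (haarFrame (kPar_le n)))
    {q | ∃ x, A.output (oracle p (gHard p q.2)) (kPar n - 1) q.1 = some x ∧
      IsApproxMin (epsPar n) (gHard p q.2) x}

end SmoothConvexLB

end

open SmoothConvexLB

noncomputable section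

namespace SmoothConvexLB

/-! Coordinate ℓ of `vecV` carries the offset (k-ℓ)γ. So near a point almost orthogonal to v_i, …,
v_k, coordinate i exceeds every later one by a fixed fraction of γ, and for j > i the terms i+1, …,
j raise the softmax by at most ρ(j-i)n^{-α}, which is exactly the bonus of f_i over f_j. Hence h
equals max_{j ≤ i} f_j on a ball of radius β; the iterated averages reach less far than β, so the
oracle of g reveals only v_1, …, v_i (`fHard_le_fHard`, `oracle_gHard_eq`).

Compare the algorithm with a run whose i-th answer is taken from the truncation `gPre` by decree
(`hypAnswers`). For a fixed seed its i-th point is a function of v_1, …, v_{i-1} alone. Haar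
invariance and Hoeffding's inequality then make it, if it lies in the unit ball, almost orthogonal
to each remaining vector, up to probability 2n^{-25} (`haarFrame_tail`, `tail_le`). Outside the
union of at most k² such events both runs coincide, and an output in the ball after at most k-1
queries is almost orthogonal to v_k (`runFrom_not_isApproxMin`). There g is at least about -γ/4,
whereas at -(v_1+…+v_k)/√k it is at most about -1/√k + kγ ≤ -0.9/√k, so the output is not optimal
(`not_isApproxMin`).

The regularity theory serves measurability: p averages make a Lipschitz function C^p, and the
truncated answers then depend measurably on V and the query. -/

/-! ### Integration over moving balls -/

/-- The integral of `f` over the closed ball of radius `η` around `x`. -/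
def ballInt {n : ℕ} {F : Type*} [NormedAddCommGroup F] [NormedSpace ℝ F] (η : ℝ) (f : E n → F)
    (x : E n) : F :=
  ∫ y in Metric.closedBall (0 : E n) η, f (x + y)

theorem ballInt_eq_setIntegral {n : ℕ} {F : Type*} [NormedAddCommGroup F] [NormedSpace ℝ F]
    (η : ℝ) (f : E n → F) (x : E n) : ballInt η f x = ∫ y in Metric.closedBall x η, f y := by
  have h := (measurePreserving_add_left (volume : Measure (E n)) x).setIntegral_preimage_emb
    (MeasurableEquiv.addLeft x).measurableEmbedding f (Metric.closedBall x η)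
  rw [← h, ballInt]
  congr 2
  ext y
  simp

theorem volume_real_closedBall {n : ℕ} (η : ℝ) (x : E n) :
    (volume : Measure (E n)).real (Metric.closedBall x η)
      = (volume : Measure (E n)).real (Metric.closedBall 0 η) := by
  simp only [Measure.real, Measure.addHaar_closedBall_center]

theorem ballSmooth_eq_ballInt {n : ℕ} (η : ℝ) (f : E n → ℝ) :
    ballSmooth η f
      = fun x => ((volume : Measure (E n)).real (Metric.closedBall 0 η))⁻¹ • ballInt η f x := by
  funext x
  rw [ballSmooth, setAverage_eq, volume_real_closedBall, ballInt_eq_setIntegral]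

/-- The crescent lies in a shell of thickness `dist x x'` around the second ball, and the volume of
that shell is a difference of n-th powers. -/
theorem volume_closedBall_sdiff_le {n : ℕ} {η : ℝ} (hη : 0 ≤ η) (x x' : E n)
    (h : dist x x' ≤ 1) :
    (volume : Measure (E n)).real (Metric.closedBall x η \ Metric.closedBall x' η)
      ≤ (n * (η + 1) ^ (n - 1) * (volume : Measure (E n)).real (Metric.ball 0 1)) * dist x x' := by
  set d := dist x x' with hd
  have hd0 : 0 ≤ d := dist_nonneg
  have hsub : Metric.closedBall x η \ Metric.closedBall x' η
      ⊆ Metric.closedBall x' (η + d) \ Metric.closedBall x' η := by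
    refine Set.sdiff_subset_sdiff_left (Metric.closedBall_subset_closedBall' ?_)
    rw [hd]
  have hin : Metric.closedBall x' η ⊆ Metric.closedBall x' (η + d) :=
    Metric.closedBall_subset_closedBall (by linarith)
  have hfin : (volume : Measure (E n)) (Metric.closedBall x' (η + d)) ≠ ∞ :=
    measure_closedBall_lt_top.ne
  calc (volume : Measure (E n)).real (Metric.closedBall x η \ Metric.closedBall x' η)
      ≤ (volume : Measure (E n)).real (Metric.closedBall x' (η + d) \ Metric.closedBall x' η) :=
        measureReal_mono hsub (ne_top_of_le_ne_top hfin (measure_mono Set.sdiff_subset))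
    _ = ((η + d) ^ n - η ^ n) * (volume : Measure (E n)).real (Metric.ball 0 1) := by
        rw [measureReal_sdiff hin Metric.isClosed_closedBall.measurableSet
            (measure_closedBall_lt_top.ne),
          Measure.addHaar_real_closedBall _ _ hη, Measure.addHaar_real_closedBall _ _ (by linarith),
          finrank_euclideanSpace, Fintype.card_fin]
        ring
    _ ≤ (d * n * (η + 1) ^ (n - 1)) * (volume : Measure (E n)).real (Metric.ball 0 1) := by
        refine mul_le_mul_of_nonneg_right ?_ measureReal_nonneg
        have h1 := abs_pow_sub_pow_le (η + d) η n
        have h2 : max |η + d| |η| ≤ η + 1 := by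
          rw [abs_of_nonneg hη, abs_of_nonneg (by linarith)]
          exact max_le (by linarith) (by linarith)
        calc (η + d) ^ n - η ^ n ≤ |(η + d) ^ n - η ^ n| := le_abs_self _
          _ ≤ |η + d - η| * n * max |η + d| |η| ^ (n - 1) := h1
          _ ≤ d * n * (η + 1) ^ (n - 1) := by
            rw [add_sub_cancel_left, abs_of_nonneg hd0]
            gcongr
    _ = _ := by ring

/-- Integration over moving balls turns bounded functions into Lipschitz functions. -/
theorem exists_lipschitzWith_ballInt_of_bounded {n : ℕ} {F : Type*} [NormedAddCommGroup F]
    [NormedSpace ℝ F] {η C : ℝ} (hη : 0 ≤ η) (f : E n → F) (hf : AEStronglyMeasurable f volume)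
    (hC : ∀ x, ‖f x‖ ≤ C) : ∃ K, LipschitzWith K (ballInt η f) := by
  have hC0 : 0 ≤ C := (norm_nonneg _).trans (hC 0)
  set W := (volume : Measure (E n)).real (Metric.closedBall 0 η) with hW
  set K := (n * (η + 1) ^ (n - 1) * (volume : Measure (E n)).real (Metric.ball 0 1)) with hK
  have hW0 : 0 ≤ W := measureReal_nonneg
  have hK0 : 0 ≤ K := by positivity
  have hint : ∀ x : E n, IntegrableOn f (Metric.closedBall x η) := fun x =>
    Measure.integrableOn_of_bounded measure_closedBall_lt_top.ne hf
      (Eventually.of_forall hC)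
  refine ⟨⟨2 * C * (W + K), by positivity⟩, LipschitzWith.of_dist_le_mul fun x x' => ?_⟩
  change _ ≤ 2 * C * (W + K) * _
  rw [dist_eq_norm]
  rcases le_total (dist x x') 1 with h | h
  -- For close centers the common part of the balls cancels and only two crescents remain.
  · have key : ∀ u v : E n, dist u v ≤ 1 →
        ‖∫ y in Metric.closedBall u η \ Metric.closedBall v η, f y‖ ≤ C * (K * dist u v) := by
      intro u v huv
      refine (norm_setIntegral_le_of_norm_le_const
        (lt_of_le_of_lt (measure_mono Set.sdiff_subset) measure_closedBall_lt_top)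
        (fun y _ => hC y)).trans ?_
      exact mul_le_mul_of_nonneg_left (volume_closedBall_sdiff_le hη u v huv) hC0
    have h1 := integral_inter_add_sdiff (Metric.isClosed_closedBall (x := x')
      (ε := η)).measurableSet (hint x)
    have h2 := integral_inter_add_sdiff (Metric.isClosed_closedBall (x := x)
      (ε := η)).measurableSet (hint x')
    rw [Set.inter_comm] at h2
    rw [ballInt_eq_setIntegral, ballInt_eq_setIntegral, ← h1, ← h2, add_sub_add_left_eq_sub]
    refine (norm_sub_le _ _).trans ?_
    have h3 := key x x' h
    have h4 := key x' x (by rwa [dist_comm])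
    rw [dist_comm x' x] at h4
    have : 0 ≤ C * W * dist x x' := by positivity
    nlinarith
  -- For distant centers the sup bound suffices, since the distance is at least 1.
  · have key : ∀ u : E n, ‖ballInt η f u‖ ≤ C * W := by
      intro u
      exact norm_setIntegral_le_of_norm_le_const measure_closedBall_lt_top (fun y _ => hC _)
    refine (norm_sub_le _ _).trans ?_
    have h3 := key x
    have h4 := key x'
    have h5 : C * W ≤ C * W * dist x x' := le_mul_of_one_le_right (by positivity) h
    have : 0 ≤ C * K * dist x x' := by positivity
    nlinarith

theorem lipschitzWith_ballInt {n : ℕ} {F : Type*} [NormedAddCommGroup F]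
    [NormedSpace ℝ F] {η : ℝ} {C : NNReal} {f : E n → F} (hf : LipschitzWith C f) :
    ∃ K, LipschitzWith K (ballInt η f) := by
  set W := (volume : Measure (E n)).real (Metric.closedBall 0 η) with hW
  have hint : ∀ x : E n, IntegrableOn (fun y => f (x + y)) (Metric.closedBall 0 η) := fun x =>
    (hf.continuous.comp (continuous_const.add continuous_id)).continuousOn.integrableOn_compact
      (isCompact_closedBall _ _)
  refine ⟨⟨C * W, by positivity⟩, LipschitzWith.of_dist_le_mul fun x x' => ?_⟩
  change _ ≤ C * W * _
  rw [dist_eq_norm, ballInt, ballInt, ← integral_sub (hint x) (hint x')]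
  refine (norm_setIntegral_le_of_norm_le_const (C := C * dist x x') measure_closedBall_lt_top
    fun y _ => ?_).trans (by rw [← hW]; apply le_of_eq; ring)
  rw [← dist_eq_norm]
  simpa using hf.dist_le_mul (x + y) (x' + y)

theorem aestronglyMeasurable_fderiv_of_finiteDimensional {n : ℕ} {F : Type*}
    [NormedAddCommGroup F] [NormedSpace ℝ F] [FiniteDimensional ℝ F] (f : E n → F)
    (μ : Measure (E n)) : AEStronglyMeasurable (fderiv ℝ f) μ := by
  have : CompleteSpace F := FiniteDimensional.complete ℝ F
  have : ProperSpace (E n →L[ℝ] F) := FiniteDimensional.proper ℝ _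
  have : SecondCountableTopology (E n →L[ℝ] F) := inferInstance
  exact (measurable_fderiv ℝ f).aestronglyMeasurable

/-- A Lipschitz function may be differentiated under the integral over moving balls. -/
theorem hasFDerivAt_ballInt {n : ℕ} {F : Type*} [NormedAddCommGroup F] [NormedSpace ℝ F]
    [FiniteDimensional ℝ F] {η : ℝ} {C : NNReal} {f : E n → F} (hf : LipschitzWith C f)
    (x : E n) : HasFDerivAt (ballInt η f) (ballInt η (fderiv ℝ f) x) x := by
  have hcont : ∀ z : E n, Continuous fun y => f (z + y) := fun z =>
    hf.continuous.comp (continuous_const.add continuous_id)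
  have hmp := measurePreserving_add_left (volume : Measure (E n)) x
  -- Rademacher's theorem, transported along a measure-preserving translation.
  have hae : ∀ᵐ y : E n, DifferentiableAt ℝ f (x + y) :=
    hmp.quasiMeasurePreserving.ae hf.ae_differentiableAt
  refine (hasFDerivAt_integral_of_dominated_loc_of_lip (F := fun z y => f (z + y))
    (F' := fun y => fderiv ℝ f (x + y)) (bound := fun _ => (C : ℝ)) (s := Set.univ) (x₀ := x)
    univ_mem ?_ ?_ ?_ ?_ ?_ ?_).2
  · exact Eventually.of_forall fun z => (hcont z).aestronglyMeasurable
  · exact (hcont x).continuousOn.integrableOn_compact (isCompact_closedBall _ _)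
  · exact ((aestronglyMeasurable_fderiv_of_finiteDimensional f volume).comp_measurePreserving
      hmp).restrict
  · refine Eventually.of_forall fun y => ?_
    have : Real.nnabs (C : ℝ) = C := by simp
    rw [this]
    refine (LipschitzWith.of_dist_le_mul fun z w => ?_).lipschitzOnWith
    simpa using hf.dist_le_mul (z + y) (w + y)
  · exact integrableOn_const measure_closedBall_lt_top.ne
  · refine ae_restrict_of_ae (hae.mono fun y hy => ?_)
    exact hy.hasFDerivAt.comp x ((hasFDerivAt_id x).add_const y)

/-! ### Functions with Lipschitz derivatives -/

/-- `f` is `m` times differentiable, and `f` and its derivatives of order up to `m` are Lipschitz. -/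
def IterLip {n : ℕ} : (m : ℕ) → {F : Type} → [NormedAddCommGroup F] → [NormedSpace ℝ F] →
    (E n → F) → Prop
  | 0, _, _, _, f => ∃ C, LipschitzWith C f
  | m + 1, _, _, _, f => (∃ C, LipschitzWith C f) ∧ Differentiable ℝ f ∧ IterLip m (fderiv ℝ f)

theorem IterLip.contDiff {n m : ℕ} {F : Type} [NormedAddCommGroup F] [NormedSpace ℝ F]
    {f : E n → F} (hf : IterLip m f) : ContDiff ℝ m f := by
  induction m generalizing F with
  | zero =>
    obtain ⟨C, hC⟩ := hf
    exact contDiff_zero.2 hC.continuous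
  | succ m ih =>
    obtain ⟨-, h1, h2⟩ := hf
    push_cast
    exact contDiff_succ_iff_fderiv.2 ⟨h1, by simp, ih h2⟩

theorem IterLip.lipschitz {n m : ℕ} {F : Type} [NormedAddCommGroup F] [NormedSpace ℝ F]
    {f : E n → F} (hf : IterLip m f) : ∃ C, LipschitzWith C f := by
  cases m with
  | zero => exact hf
  | succ m => exact hf.1

theorem IterLip.const_smul {n m : ℕ} {F : Type} [NormedAddCommGroup F] [NormedSpace ℝ F]
    {f : E n → F} (hf : IterLip m f) (c : ℝ) : IterLip m (fun x => c • f x) := by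
  have hlip : ∃ C, LipschitzWith C (fun x => c • f x) := by
    obtain ⟨C, hC⟩ := hf.lipschitz
    exact ⟨_, (lipschitzWith_smul c).comp hC⟩
  induction m generalizing F with
  | zero => exact hlip
  | succ m ih =>
    obtain ⟨-, h1, h2⟩ := hf
    refine ⟨hlip, h1.const_smul c, ?_⟩
    have : fderiv ℝ (fun x => c • f x) = fun x => c • fderiv ℝ f x := by
      funext x
      exact fderiv_fun_const_smul (h1 x) c
    rw [this]
    refine ih h2 ?_
    obtain ⟨C, hC⟩ := h2.lipschitz
    exact ⟨_, (lipschitzWith_smul c).comp hC⟩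

/-- Each ball integral gains one derivative, because differentiation commutes with it. In the base
case the derivative of `f` exists only almost everywhere, but it is bounded, so its ball integral is
again Lipschitz. -/
theorem IterLip.ballInt {n m : ℕ} {F : Type} [NormedAddCommGroup F] [NormedSpace ℝ F]
    [FiniteDimensional ℝ F] {f : E n → F} (hf : IterLip m f) {η : ℝ} (hη : 0 ≤ η) :
    IterLip (m + 1) (ballInt η f) := by
  induction m generalizing F with
  | zero =>
    obtain ⟨C, hC⟩ := hf
    have h := hasFDerivAt_ballInt (η := η) hC
    refine ⟨lipschitzWith_ballInt hC, fun x => (h x).differentiableAt, ?_⟩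
    have : fderiv ℝ (SmoothConvexLB.ballInt η f) = SmoothConvexLB.ballInt η (fderiv ℝ f) :=
      funext fun x => (h x).fderiv
    rw [this]
    exact exists_lipschitzWith_ballInt_of_bounded hη _
      (aestronglyMeasurable_fderiv_of_finiteDimensional f volume)
      fun x => norm_fderiv_le_of_lipschitz ℝ hC
  | succ m ih =>
    obtain ⟨⟨C, hC⟩, -, h2⟩ := hf
    have h := hasFDerivAt_ballInt (η := η) hC
    refine ⟨lipschitzWith_ballInt hC, fun x => (h x).differentiableAt, ?_⟩
    have : fderiv ℝ (SmoothConvexLB.ballInt η f) = SmoothConvexLB.ballInt η (fderiv ℝ f) :=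
      funext fun x => (h x).fderiv
    rw [this]
    exact ih h2

theorem iterLip_smoothing {n : ℕ} {β : ℝ} (hβ : 0 ≤ β) {f : E n → ℝ} {C : NNReal}
    (hf : LipschitzWith C f) (p : ℕ) : IterLip p (smoothing β p f) := by
  induction p with
  | zero => exact ⟨C, hf⟩
  | succ p ih =>
    rw [smoothing, ballSmooth_eq_ballInt]
    exact (ih.ballInt (by positivity)).const_smul _

/-! ### Locality, monotonicity and continuity of the smoothing -/

theorem ballSmooth_congr {n : ℕ} {η : ℝ} {f f' : E n → ℝ} {x : E n}
    (h : ∀ y ∈ Metric.closedBall x η, f y = f' y) : ballSmooth η f x = ballSmooth η f' x := by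
  rw [ballSmooth, ballSmooth, setAverage_eq, setAverage_eq,
    setIntegral_congr_fun Metric.isClosed_closedBall.measurableSet h]

theorem ballSmooth_le {n : ℕ} {η : ℝ} (hη : 0 < η) {f : E n → ℝ} (hf : Continuous f) {x : E n}
    {c : ℝ} (h : ∀ y ∈ Metric.closedBall x η, f y ≤ c) : ballSmooth η f x ≤ c := by
  have hpos : 0 < (volume : Measure (E n)).real (Metric.closedBall x η) :=
    ENNReal.toReal_pos (Metric.measure_closedBall_pos _ _ hη).ne' measure_closedBall_lt_top.ne
  rw [ballSmooth, setAverage_eq, smul_eq_mul, inv_mul_le_iff₀ hpos]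
  calc ∫ y in Metric.closedBall x η, f y
      ≤ ∫ y in Metric.closedBall x η, c :=
        setIntegral_mono_on (hf.continuousOn.integrableOn_compact (isCompact_closedBall _ _))
          (integrableOn_const measure_closedBall_lt_top.ne)
          Metric.isClosed_closedBall.measurableSet h
    _ = _ := by simp

theorem ballSmooth_neg {n : ℕ} {η : ℝ} (f : E n → ℝ) :
    ballSmooth η (fun y => -f y) = fun x => -ballSmooth η f x := by
  funext x
  simp [ballSmooth, setAverage_eq]

theorem smoothing_neg {n : ℕ} (β : ℝ) (p : ℕ) (f : E n → ℝ) :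
    smoothing β p (fun y => -f y) = fun x => -smoothing β p f x := by
  induction p with
  | zero => rfl
  | succ p ih => rw [smoothing, ih, ballSmooth_neg]; rfl

/-- The radii β/2, β/4, … form a geometric series, so p rounds of averaging reach only β(1 - 2^{-p})
and leave a margin of β/2^p inside the ball of radius β. -/
theorem mem_closedBall_of_half_radius {n p : ℕ} {β : ℝ} {x y z : E n}
    (hy : y ∈ Metric.closedBall x (β / 2 ^ (p + 1)))
    (hz : z ∈ Metric.closedBall y (β * (1 - (1 / 2) ^ p))) :
    z ∈ Metric.closedBall x (β * (1 - (1 / 2) ^ (p + 1))) := by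
  rw [Metric.mem_closedBall] at *
  have h1 := dist_triangle z y x
  have h2 : β / 2 ^ (p + 1) = β * ((1 / 2) ^ p / 2) := by
    rw [pow_succ, one_div, inv_pow]; field_simp
  rw [h2] at hy
  rw [pow_succ]
  linarith

theorem smoothing_congr {n : ℕ} {β : ℝ} (p : ℕ) {f f' : E n → ℝ} {x : E n}
    (h : ∀ y ∈ Metric.closedBall x (β * (1 - (1 / 2) ^ p)), f y = f' y) :
    smoothing β p f x = smoothing β p f' x := by
  induction p generalizing x with
  | zero => exact h x (by simp)
  | succ p ih =>
    refine ballSmooth_congr fun y hy => ih fun z hz => h z ?_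
    exact mem_closedBall_of_half_radius hy hz

/-- The parameter stands for the frame `V`: joint continuity in frame and point supplies the
measurability needed of the truncated run. -/
theorem continuous_ballSmooth_param {n : ℕ} {X : Type*} [TopologicalSpace X]
    [FirstCountableTopology X] [LocallyCompactSpace X] (η : ℝ) {f : X → E n → ℝ}
    (hf : Continuous fun q : X × E n => f q.1 q.2) :
    Continuous fun q : X × E n => ballSmooth η (f q.1) q.2 := by
  simp only [ballSmooth_eq_ballInt]
  have h : Continuous fun z : (X × E n) × E n => (z.1.1, z.1.2 + z.2) := by fun_prop
  have hc : Continuous (Function.uncurry fun (q : X × E n) (y : E n) => f q.1 (q.2 + y)) :=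
    hf.comp h
  exact (continuous_parametric_integral_of_continuous (μ := volume) hc
    (isCompact_closedBall (0 : E n) η)).const_smul
      ((volume : Measure (E n)).real (Metric.closedBall 0 η))⁻¹

theorem continuous_smoothing_param {n : ℕ} {X : Type*} [TopologicalSpace X]
    [FirstCountableTopology X] [LocallyCompactSpace X] (β : ℝ) (p : ℕ) {f : X → E n → ℝ}
    (hf : Continuous fun q : X × E n => f q.1 q.2) :
    Continuous fun q : X × E n => smoothing β p (f q.1) q.2 := by
  induction p with
  | zero => exact hf
  | succ p ih => exact continuous_ballSmooth_param (f := fun v => smoothing β p (f v)) _ ih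

theorem continuous_smoothing {n : ℕ} (β : ℝ) (p : ℕ) {f : E n → ℝ} (hf : Continuous f) :
    Continuous (smoothing β p f) :=
  (continuous_smoothing_param (X := Unit) β p (f := fun _ => f) (hf.comp continuous_snd)).comp
    (Continuous.prodMk_right ())

theorem smoothing_le {n : ℕ} {β : ℝ} (hβ : 0 < β) (p : ℕ) {f : E n → ℝ} (hf : Continuous f)
    {x : E n} {c : ℝ} (h : ∀ y ∈ Metric.closedBall x (β * (1 - (1 / 2) ^ p)), f y ≤ c) :
    smoothing β p f x ≤ c := by
  induction p generalizing x with
  | zero => exact h x (by simp)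
  | succ p ih =>
    refine ballSmooth_le (by positivity) (continuous_smoothing β p hf) fun y hy =>
      ih fun z hz => h z ?_
    exact mem_closedBall_of_half_radius hy hz

theorem le_smoothing {n : ℕ} {β : ℝ} (hβ : 0 < β) (p : ℕ) {f : E n → ℝ} (hf : Continuous f)
    {x : E n} {c : ℝ} (h : ∀ y ∈ Metric.closedBall x (β * (1 - (1 / 2) ^ p)), c ≤ f y) :
    c ≤ smoothing β p f x := by
  have := smoothing_le hβ p (f := fun y => -f y) hf.neg (x := x) (c := -c) fun y hy => neg_le_neg (h y hy)
  rw [smoothing_neg] at this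
  linarith

/-- The smoothings of two functions that agree on a ball have the same `p`-th order oracle at its
center. -/
theorem oracle_smoothing_congr {n : ℕ} {β : ℝ} (hβ : 0 < β) (p q : ℕ) {f f' : E n → ℝ} {x : E n}
    (h : ∀ y ∈ Metric.closedBall x β, f y = f' y) :
    oracle q (smoothing β p f) x = oracle q (smoothing β p f') x := by
  have hev : smoothing β p f =ᶠ[𝓝 x] smoothing β p f' := by
    -- The margin β/2^p makes the smoothings agree on a neighbourhood, hence all their derivatives
    -- agree at the center.
    filter_upwards [Metric.closedBall_mem_nhds x (ε := β * (1 / 2) ^ p) (by positivity)] with y hy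
    refine smoothing_congr p fun z hz => h z ?_
    rw [Metric.mem_closedBall] at *
    have := dist_triangle z y x
    linarith
  funext i J
  rw [oracle, oracle, (hev.iteratedFDeriv ℝ (i : ℕ)).self_of_nhds]

/-! ### Measurability of the oracle -/

/-- If `g v` is `C^p` for every `v`, and `g` is jointly measurable, then the partial derivatives
of order at most `p` of `g v` are jointly measurable. -/
theorem measurable_iteratedFDeriv_apply {n p : ℕ} {X : Type*} [MeasurableSpace X]
    {g : X → E n → ℝ} (hg : Measurable fun q : X × E n => g q.1 q.2)
    (hsmooth : ∀ v, ContDiff ℝ p (g v)) (i : ℕ) (hi : i ≤ p) (m : Fin i → E n) :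
    Measurable fun q : X × E n => iteratedFDeriv ℝ i (g q.1) q.2 m := by
  induction i with
  | zero => simpa using hg
  | succ i ih =>
    -- A derivative of order i+1 is the pointwise limit of difference quotients of order-i
    -- derivatives in direction `m 0`, with steps 1/(j+1).
    have hmeas : ∀ j : ℕ, Measurable fun q : X × E n =>
        ((1 / ((j : ℝ) + 1))⁻¹ : ℝ) • (iteratedFDeriv ℝ i (g q.1)
          (q.2 + (1 / ((j : ℝ) + 1)) • m 0) (Fin.tail m)
            - iteratedFDeriv ℝ i (g q.1) q.2 (Fin.tail m)) := by
      intro j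
      have h0 := ih (by omega) (Fin.tail m)
      have h1 : Measurable fun q : X × E n => (q.1, q.2 + (1 / ((j : ℝ) + 1)) • m 0) :=
        measurable_fst.prodMk (measurable_snd.add_const _)
      exact ((h0.comp h1).sub h0).const_smul (1 / ((j : ℝ) + 1))⁻¹
    refine measurable_of_tendsto_metrizable hmeas ?_
    rw [tendsto_pi_nhds]
    rintro ⟨v, x⟩
    have hd : DifferentiableAt ℝ (iteratedFDeriv ℝ i (g v)) x :=
      (hsmooth v).differentiable_iteratedFDeriv (by exact_mod_cast hi) x
    have h2 := (hd.hasFDerivAt.hasLineDerivAt (m 0)).tendsto_slope_zero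
    have hseq : Tendsto (fun j : ℕ => 1 / ((j : ℝ) + 1)) atTop (𝓝[≠] 0) :=
      tendsto_nhdsWithin_iff.2 ⟨tendsto_one_div_add_atTop_nhds_zero_nat,
        Eventually.of_forall fun j => (Nat.one_div_pos_of_nat (α := ℝ)).ne'⟩
    have h3 := h2.comp hseq
    have h4 := ((ContinuousMultilinearMap.apply ℝ (fun _ : Fin i => E n) ℝ
      (Fin.tail m)).continuous.tendsto _).comp h3
    exact h4

theorem measurable_oracle {n p : ℕ} {X : Type*} [MeasurableSpace X]
    {g : X → E n → ℝ} (hg : Measurable fun q : X × E n => g q.1 q.2)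
    (hsmooth : ∀ v, ContDiff ℝ p (g v)) :
    Measurable fun q : X × E n => oracle p (g q.1) q.2 := by
  refine measurable_pi_lambda _ fun i => measurable_pi_lambda _ fun J => ?_
  exact measurable_iteratedFDeriv_apply hg hsmooth i (by omega) _

/-! ### Rademacher sums -/

/-- The sign of a Boolean. -/
def sgn (b : Bool) : ℝ := if b then 1 else -1

/-- The sum over signs factors over the coordinates, and each factor obeys cosh b ≤ exp(b²/2). -/
theorem sum_exp_signs_le {n : ℕ} (b : Fin n → ℝ) :
    ∑ s : Fin n → Bool, Real.exp (∑ a, sgn (s a) * b a)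
      ≤ 2 ^ n * Real.exp ((∑ a, b a ^ 2) / 2) := by
  calc ∑ s : Fin n → Bool, Real.exp (∑ a, sgn (s a) * b a)
      = ∏ a, ∑ ε : Bool, Real.exp (sgn ε * b a) := by
        rw [Finset.prod_univ_sum, Fintype.piFinset_univ]
        simp [Real.exp_sum]
    _ ≤ ∏ a, 2 * Real.exp (b a ^ 2 / 2) := by
        refine Finset.prod_le_prod (fun a _ => by positivity) fun a _ => ?_
        have h := Real.cosh_le_exp_half_sq (b a)
        rw [Real.cosh_eq] at h
        simp only [Fintype.sum_bool, sgn]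
        simp only [if_true, Bool.false_eq_true, if_false, one_mul, neg_mul]
        linarith
    _ = _ := by
        rw [Finset.prod_mul_distrib, ← Real.exp_sum, Finset.sum_div]
        simp

/-- Hoeffding's inequality for Rademacher sums. -/
theorem card_signs_le {n : ℕ} (b : Fin n → ℝ) {σ t : ℝ} (hσ : 0 < σ) (hb : ∑ a, b a ^ 2 ≤ σ)
    (ht : 0 ≤ t) :
    ((Finset.univ.filter fun s : Fin n → Bool => t < |∑ a, sgn (s a) * b a|).card : ℝ)
      ≤ 2 ^ n * (2 * Real.exp (-t ^ 2 / (2 * σ))) := by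
  -- This choice minimizes the Chernoff exponent -ct + c²σ/2.
  set c := t / σ with hc
  have hc0 : 0 ≤ c := by positivity
  have hexp : ∀ r : ℝ, r ^ 2 = c ^ 2 →
      ∑ s : Fin n → Bool, Real.exp (r * ∑ a, sgn (s a) * b a)
        ≤ 2 ^ n * Real.exp (c ^ 2 * σ / 2) := by
    intro r hr
    have h := sum_exp_signs_le fun a => r * b a
    have h1 : ∀ s : Fin n → Bool, ∑ a, sgn (s a) * (r * b a) = r * ∑ a, sgn (s a) * b a := by
      intro s
      rw [Finset.mul_sum]
      exact Finset.sum_congr rfl fun a _ => by ring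
    simp only [h1] at h
    refine h.trans ?_
    have h2 : ∑ a, (r * b a) ^ 2 ≤ c ^ 2 * σ := by
      simp only [mul_pow, ← Finset.mul_sum, hr]
      gcongr
    gcongr
  have hpt : ∀ s : Fin n → Bool, (if t < |∑ a, sgn (s a) * b a| then (1 : ℝ) else 0)
      ≤ Real.exp (-(c * t)) * (Real.exp (c * ∑ a, sgn (s a) * b a)
        + Real.exp (-c * ∑ a, sgn (s a) * b a)) := by
    intro s
    set S := ∑ a, sgn (s a) * b a
    split_ifs with h
    · rw [mul_add, ← Real.exp_add, ← Real.exp_add]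
      rcases lt_abs.1 h with h | h
      · have h1 : 1 ≤ Real.exp (-(c * t) + c * S) := Real.one_le_exp (by nlinarith)
        have h2 := Real.exp_pos (-(c * t) + -c * S)
        linarith
      · have h1 : 1 ≤ Real.exp (-(c * t) + -c * S) := Real.one_le_exp (by nlinarith)
        have h2 := Real.exp_pos (-(c * t) + c * S)
        linarith
    · positivity
  calc ((Finset.univ.filter fun s : Fin n → Bool => t < |∑ a, sgn (s a) * b a|).card : ℝ)
      = ∑ s : Fin n → Bool, (if t < |∑ a, sgn (s a) * b a| then (1 : ℝ) else 0) := by simp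
    _ ≤ ∑ s : Fin n → Bool, Real.exp (-(c * t)) * (Real.exp (c * ∑ a, sgn (s a) * b a)
        + Real.exp (-c * ∑ a, sgn (s a) * b a)) := Finset.sum_le_sum fun s _ => hpt s
    _ = Real.exp (-(c * t)) * (∑ s : Fin n → Bool, Real.exp (c * ∑ a, sgn (s a) * b a)
        + ∑ s : Fin n → Bool, Real.exp (-c * ∑ a, sgn (s a) * b a)) := by
        rw [← Finset.mul_sum, Finset.sum_add_distrib]
    _ ≤ Real.exp (-(c * t)) * (2 ^ n * Real.exp (c ^ 2 * σ / 2)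
        + 2 ^ n * Real.exp (c ^ 2 * σ / 2)) := by
        gcongr
        · exact hexp c rfl
        · exact hexp (-c) (by ring)
    _ = 2 ^ n * (2 * (Real.exp (-(c * t)) * Real.exp (c ^ 2 * σ / 2))) := by ring
    _ = _ := by
        rw [← Real.exp_add]
        congr 3
        rw [hc]
        field_simp
        ring

/-! ### Householder matrices -/

/-- The matrix of the reflection that exchanges the basis vector `e_l` and the unit vector `w`. -/
def householder {n : ℕ} (w : Fin n → ℝ) (l : Fin n) : Matrix (Fin n) (Fin n) ℝ :=
  1 - (2 / ((Pi.single l 1 - w) ⬝ᵥ (Pi.single l 1 - w))) •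
    Matrix.vecMulVec (Pi.single l 1 - w) (Pi.single l 1 - w)

theorem householder_mem {n : ℕ} (w : Fin n → ℝ) (l : Fin n) :
    householder w l ∈ Matrix.orthogonalGroup (Fin n) ℝ := by
  rw [Matrix.mem_orthogonalGroup_iff]
  set u : Fin n → ℝ := Pi.single l 1 - w with hu
  have hT : (householder w l).transpose = householder w l := by
    simp [householder, Matrix.transpose_vecMulVec]
  change householder w l * (householder w l).transpose = 1
  rw [hT, householder, ← hu]
  -- If u = 0, the convention 2/0 = 0 turns the reflection into the identity.
  rcases eq_or_ne (u ⬝ᵥ u) 0 with h | h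
  · simp [h]
  · have hsq : Matrix.vecMulVec u u * Matrix.vecMulVec u u
        = (u ⬝ᵥ u) • Matrix.vecMulVec u u := by
      rw [Matrix.vecMulVec_mul_vecMulVec, Matrix.vecMulVec_smul]
    rw [sub_mul, mul_sub, mul_sub, one_mul, mul_one, one_mul, Matrix.smul_mul, Matrix.mul_smul,
      hsq, smul_smul, smul_smul]
    have : 2 / (u ⬝ᵥ u) * (2 / (u ⬝ᵥ u)) * (u ⬝ᵥ u) = 2 / (u ⬝ᵥ u) + 2 / (u ⬝ᵥ u) := by
      field_simp; norm_num
    rw [this, add_smul]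
    abel

theorem householder_apply_self {n : ℕ} {w : Fin n → ℝ} (hw : ∑ a, w a ^ 2 = 1) (l b : Fin n) :
    householder w l b l = w b := by
  set u : Fin n → ℝ := Pi.single l 1 - w with hu
  have huu : u ⬝ᵥ u = 2 - 2 * w l := by
    have hww : w ⬝ᵥ w = 1 := by
      rw [← hw, dotProduct]
      exact Finset.sum_congr rfl fun a _ => by ring
    rw [hu, sub_dotProduct, dotProduct_sub, dotProduct_sub, hww]
    simp
    ring
  have hb : (1 : Matrix (Fin n) (Fin n) ℝ) b l = (Pi.single l 1 : Fin n → ℝ) b := by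
    simp [Matrix.one_apply, Pi.single_apply]
  have hul : u l = 1 - w l := by simp [hu]
  have hub : u b = (Pi.single l 1 : Fin n → ℝ) b - w b := by simp [hu]
  rw [householder, ← hu, Matrix.sub_apply, Matrix.smul_apply, Matrix.vecMulVec_apply, hb, huu,
    hul, smul_eq_mul]
  -- For a unit vector, w l = 1 forces w = e_l, the degenerate case again.
  rcases eq_or_ne (1 - w l) 0 with h | h
  · have h0 : u ⬝ᵥ u = 0 := by rw [huu]; linarith
    have h1 : u = 0 := by simpa using h0
    rw [h, mul_zero, mul_zero, sub_zero]
    rw [h1] at hub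
    simp only [Pi.zero_apply] at hub
    linarith
  · have h2 : (2 : ℝ) - 2 * w l = 2 * (1 - w l) := by ring
    rw [h2]
    field_simp
    rw [hub]
    ring

theorem householder_apply_of_ne {n : ℕ} {w : Fin n → ℝ} {l j : Fin n} (hj : j ≠ l)
    (hwj : w j = 0) (b : Fin n) :
    householder w l b j = (1 : Matrix (Fin n) (Fin n) ℝ) b j := by
  simp [householder, Matrix.vecMulVec_apply, hwj, hj]

/-! ### Tails for Haar-random orthonormal vectors -/

/-- The `b`-th column of an orthogonal matrix. -/
def column {n : ℕ} (U : Matrix.orthogonalGroup (Fin n) ℝ) (b : Fin n) : E n :=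
  WithLp.toLp 2 fun a => (U : Matrix (Fin n) (Fin n) ℝ) a b

theorem orthonormal_column {n : ℕ} (U : Matrix.orthogonalGroup (Fin n) ℝ) :
    Orthonormal ℝ (column U) := by
  rw [orthonormal_iff_ite]
  intro i j
  have h := congrFun (congrFun ((Matrix.mem_orthogonalGroup_iff' (Fin n) ℝ).1 U.2) i) j
  rw [Matrix.one_apply] at h
  rw [← h, Matrix.mul_apply, PiLp.inner_apply]
  simp [column, mul_comm]

theorem continuous_column {n : ℕ} (b : Fin n) :
    Continuous fun U : Matrix.orthogonalGroup (Fin n) ℝ => column U b := by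
  refine (PiLp.continuous_toLp 2 _).comp (continuous_pi fun a => ?_)
  exact (continuous_subtype_val (p := (· ∈ Matrix.orthogonalGroup (Fin n) ℝ))).matrix_elem a _

theorem inner_column_mul {n : ℕ} (U R : Matrix.orthogonalGroup (Fin n) ℝ) (b : Fin n) (x : E n) :
    inner ℝ (column (U * R) b) x
      = ∑ c, (R : Matrix (Fin n) (Fin n) ℝ) c b * inner ℝ (column U c) x := by
  have : column (U * R) b = ∑ c, (R : Matrix (Fin n) (Fin n) ℝ) c b • column U c := by
    ext a
    simp [column, Matrix.mul_apply, mul_comm]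
  rw [this, sum_inner]
  simp [real_inner_smul_left]

/-- Right translation commutes with left translation, so the image is again a Haar probability
measure; uniqueness identifies the two. -/
theorem haarO_map_mul_right (n : ℕ) (R : Matrix.orthogonalGroup (Fin n) ℝ) :
    (haarO n).map (fun U => U * R) = haarO n := by
  have : (haarO n).IsHaarMeasure := Measure.isHaarMeasure_haarMeasure _
  have hc : Continuous fun U : Matrix.orthogonalGroup (Fin n) ℝ => U * R :=
    continuous_id.mul continuous_const
  have h2 := Measure.isHaarMeasure_map_mul_right (haarO n) R
  have h3 : IsProbabilityMeasure ((haarO n).map (fun U => U * R)) :=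
    Measure.isProbabilityMeasure_map hc.measurable.aemeasurable
  exact Measure.isHaarMeasure_eq_of_isProbabilityMeasure _ _

/-- A random unit vector supported on the coordinates from `i` on. -/
def signVec {n : ℕ} (i : ℕ) (s : Fin n → Bool) (a : Fin n) : ℝ :=
  if (a : ℕ) < i then 0 else sgn (s a) / √((n : ℝ) - i)

theorem sgn_sq (b : Bool) : sgn b ^ 2 = 1 := by
  cases b <;> simp [sgn]

theorem sum_signVec_sq {n i : ℕ} (hi : i < n) (s : Fin n → Bool) :
    ∑ a, signVec i s a ^ 2 = 1 := by
  have hni : (0 : ℝ) < (n : ℝ) - i := by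
    have : (i : ℝ) < n := by exact_mod_cast hi
    linarith
  have h1 : ∀ a : Fin n, signVec i s a ^ 2 = if (a : ℕ) < i then 0 else 1 / ((n : ℝ) - i) := by
    intro a
    rw [signVec]
    split_ifs
    · simp
    · rw [div_pow, sgn_sq, Real.sq_sqrt hni.le]
  have hcard : (Finset.univ.filter fun a : Fin n => ¬ (a : ℕ) < i).card = n - i := by
    have h2 : (Finset.univ.filter fun a : Fin n => (a : ℕ) < i).card = i := by
      have := Fin.card_filter_val_lt (n := n) (m := i)
      simpa [hi.le] using this
    have h3 := Finset.card_filter_add_card_filter_not (s := (Finset.univ : Finset (Fin n)))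
      (fun a : Fin n => (a : ℕ) < i)
    rw [h2, Finset.card_univ, Fintype.card_fin] at h3
    omega
  simp only [h1]
  rw [Finset.sum_ite]
  simp only [Finset.sum_const_zero, Finset.sum_const, hcard, zero_add, nsmul_eq_mul]
  rw [Nat.cast_sub hi.le]
  field_simp

theorem measurableSet_large_inner {Z : Type*} [MeasurableSpace Z] {n : ℕ} {X Y : Z → E n}
    (hX : Measurable X) (hY : Measurable Y) (t : ℝ) :
    MeasurableSet {z | ‖X z‖ ≤ 1 ∧ t < |inner ℝ (Y z) (X z)|} := by
  have h1 : MeasurableSet {z | ‖X z‖ ≤ 1} := measurableSet_le hX.norm measurable_const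
  have h2 : MeasurableSet {z | t < |inner ℝ (Y z) (X z)|} :=
    measurableSet_lt measurable_const
      (Measurable.norm (f := fun z => inner ℝ (Y z) (X z)) (hY.inner hX))
  exact h1.inter h2

/-- Right multiplication by a reflection keeps the columns that `X` depends on and replaces column
`l` by a signed mean of the columns from `i` on. By invariance the event may be averaged over all
signs, and for each fixed U Hoeffding's inequality bounds the fraction of bad signs. -/
theorem haarO_tail {n i : ℕ} (hi : i < n) {l : Fin n} (hl : i ≤ l)
    {X : Matrix.orthogonalGroup (Fin n) ℝ → E n} (hX : Measurable X)
    (hdep : ∀ U U', (∀ b : Fin n, (b : ℕ) < i → column U b = column U' b) → X U = X U')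
    {t : ℝ} (ht : 0 ≤ t) :
    haarO n {U | ‖X U‖ ≤ 1 ∧ t < |inner ℝ (column U l) (X U)|}
      ≤ ENNReal.ofReal (2 * Real.exp (-(((n : ℝ) - i) * t ^ 2) / 2)) := by
  set B := 2 * Real.exp (-(((n : ℝ) - i) * t ^ 2) / 2) with hB
  set A := {U | ‖X U‖ ≤ 1 ∧ t < |inner ℝ (column U l) (X U)|} with hA
  have hni : (0 : ℝ) < (n : ℝ) - i := by
    have : (i : ℝ) < n := by exact_mod_cast hi
    linarith
  have hAm : MeasurableSet A :=
    measurableSet_large_inner hX (continuous_column l).measurable t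
  let R : (Fin n → Bool) → Matrix.orthogonalGroup (Fin n) ℝ := fun s =>
    ⟨householder (signVec i s) l, householder_mem _ _⟩
  have hRm : ∀ s, Measurable fun U : Matrix.orthogonalGroup (Fin n) ℝ => U * R s := fun s =>
    (continuous_id.mul continuous_const).measurable
  have hXR : ∀ s U, X (U * R s) = X U := by
    intro s U
    refine hdep _ _ fun b hb => ?_
    have hbl : b ≠ l := by rintro rfl; omega
    ext a
    simp only [column, Submonoid.coe_mul, Matrix.mul_apply, R]
    have h0 : signVec i s b = 0 := by simp [signVec, hb]
    simp only [householder_apply_of_ne hbl h0]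
    simp [Matrix.one_apply]
  have hmemR : ∀ s U, U * R s ∈ A ↔
      ‖X U‖ ≤ 1 ∧ t < |∑ c, signVec i s c * inner ℝ (column U c) (X U)| := by
    intro s U
    rw [hA, Set.mem_ofPred_eq, hXR, inner_column_mul]
    simp only [R, householder_apply_self (sum_signVec_sq hi s)]
  have hinv : ∀ s, haarO n A = haarO n ((fun U => U * R s) ⁻¹' A) := by
    intro s
    conv_lhs => rw [← haarO_map_mul_right n (R s)]
    rw [Measure.map_apply (hRm s) hAm]
  have hpt : ∀ U, ∑ s, ((fun U => U * R s) ⁻¹' A).indicator (1 : Matrix.orthogonalGroup (Fin n) ℝ → ℝ≥0∞) U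
      ≤ ENNReal.ofReal (2 ^ n * B) := by
    intro U
    by_cases hU : ‖X U‖ ≤ 1
    · set y : Fin n → ℝ := fun c => inner ℝ (column U c) (X U) with hy
      set b : Fin n → ℝ := fun c => if (c : ℕ) < i then 0 else y c / √((n : ℝ) - i) with hb
      -- Bessel's inequality; it makes 1/(n-i) an admissible variance bound for the Rademacher sum.
      have hy2 : ∑ c, y c ^ 2 ≤ 1 := by
        have h := (orthonormal_column U).sum_inner_products_le (x := X U) (s := Finset.univ)
        simp only [Real.norm_eq_abs, sq_abs] at h
        refine h.trans ?_
        exact pow_le_one₀ (norm_nonneg _) hU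
      have hb2 : ∑ c, b c ^ 2 ≤ 1 / ((n : ℝ) - i) := by
        calc ∑ c, b c ^ 2 ≤ ∑ c, y c ^ 2 / ((n : ℝ) - i) := by
              refine Finset.sum_le_sum fun c _ => ?_
              simp only [hb]
              split_ifs
              · rw [zero_pow two_ne_zero]; positivity
              · rw [div_pow, Real.sq_sqrt hni.le]
          _ = (∑ c, y c ^ 2) / ((n : ℝ) - i) := by rw [Finset.sum_div]
          _ ≤ _ := by gcongr
      have hcount := card_signs_le b (one_div_pos.2 hni) hb2 ht
      have hsum : ∀ s : Fin n → Bool, ∑ c, signVec i s c * y c = ∑ c, sgn (s c) * b c := by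
        intro s
        refine Finset.sum_congr rfl fun c _ => ?_
        simp only [hb, signVec]
        split_ifs
        · simp
        · ring
      have hexp : -t ^ 2 / (2 * (1 / ((n : ℝ) - i))) = -(((n : ℝ) - i) * t ^ 2) / 2 := by
        field_simp
      rw [hexp, ← hB] at hcount
      have hind : ∀ s, ((fun U => U * R s) ⁻¹' A).indicator (1 : Matrix.orthogonalGroup (Fin n) ℝ → ℝ≥0∞) U
          = if t < |∑ c, sgn (s c) * b c| then 1 else 0 := by
        intro s
        rw [← hsum s]
        split_ifs with h
        · have h' : U ∈ (fun U => U * R s) ⁻¹' A := (hmemR s U).2 ⟨hU, h⟩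
          rw [Set.indicator_of_mem h', Pi.one_apply]
        · have h' : U ∉ (fun U => U * R s) ⁻¹' A := fun h' => h ((hmemR s U).1 h').2
          exact Set.indicator_of_notMem h' _
      simp only [hind]
      rw [Finset.sum_boole, ← ENNReal.ofReal_natCast]
      exact ENNReal.ofReal_le_ofReal hcount
    · have hind : ∀ s, ((fun U => U * R s) ⁻¹' A).indicator (1 : Matrix.orthogonalGroup (Fin n) ℝ → ℝ≥0∞) U = 0 := by
        intro s
        refine Set.indicator_of_notMem ?_ _
        rw [Set.mem_preimage, hmemR]
        exact fun h => hU h.1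
      simp [hind]
  have htot : (2 : ℝ≥0∞) ^ n * haarO n A ≤ 2 ^ n * ENNReal.ofReal B := by
    calc (2 : ℝ≥0∞) ^ n * haarO n A = ∑ _s : Fin n → Bool, haarO n A := by simp
      _ = ∑ s : Fin n → Bool, ∫⁻ U, ((fun U => U * R s) ⁻¹' A).indicator 1 U ∂haarO n := by
        refine Finset.sum_congr rfl fun s _ => ?_
        rw [lintegral_indicator_one (hRm s hAm), ← hinv s]
      _ = ∫⁻ U, ∑ s : Fin n → Bool, ((fun U => U * R s) ⁻¹' A).indicator 1 U ∂haarO n := by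
        rw [lintegral_finsetSum]
        exact fun s _ => measurable_one.indicator (hRm s hAm)
      _ ≤ ∫⁻ _, ENNReal.ofReal (2 ^ n * B) ∂haarO n := lintegral_mono hpt
      _ = 2 ^ n * ENNReal.ofReal B := by
        rw [lintegral_const, measure_univ, mul_one, ENNReal.ofReal_mul (by positivity)]
        norm_num
  rwa [ENNReal.mul_le_mul_iff_right (by simp) (by simp)] at htot

/-- A point that depends only on the first `i` vectors of a Haar-random frame is nearly orthogonal
to each of the remaining ones. -/
theorem haarFrame_tail {n k i : ℕ} (hk : k ≤ n) {l : Fin k} (hl : i ≤ l)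
    {X : (Fin k → E n) → E n} (hX : Measurable X)
    (hdep : ∀ V V', (∀ b : Fin k, (b : ℕ) < i → V b = V' b) → X V = X V') {t : ℝ} (ht : 0 ≤ t) :
    haarFrame hk {V | ‖X V‖ ≤ 1 ∧ t < |inner ℝ (V l) (X V)|}
      ≤ ENNReal.ofReal (2 * Real.exp (-(((n : ℝ) - i) * t ^ 2) / 2)) := by
  have hm := (continuous_columns hk).measurable
  rw [haarFrame, Measure.map_apply hm (measurableSet_large_inner hX (measurable_pi_apply l) t)]
  have hi : i < n := by omega
  refine haarO_tail hi (l := Fin.castLE hk l) hl (X := fun U => X (columns hk U)) (hX.comp hm)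
    (fun U U' h => hdep _ _ fun b hb => h (Fin.castLE hk b) hb) ht

theorem ae_orthonormal_haarFrame {n k : ℕ} (hk : k ≤ n) :
    ∀ᵐ V ∂haarFrame hk, Orthonormal ℝ V := by
  have hclosed : IsClosed {V : Fin k → E n | Orthonormal ℝ V} := by
    simp only [orthonormal_iff_ite, Set.ofPred_forall]
    refine isClosed_iInter fun i => isClosed_iInter fun j => isClosed_eq ?_ continuous_const
    exact (continuous_apply i).inner (continuous_apply j)
  rw [haarFrame, ae_map_iff (continuous_columns hk).measurable.aemeasurable hclosed.measurableSet]
  refine Eventually.of_forall fun U => ?_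
  exact (orthonormal_column U).comp _ (Fin.castLE_injective hk)

/-! ### The parameters -/

theorem gammaPar_sq_mul {n : ℕ} (hn : 1 ≤ n) : gammaPar n ^ 2 * n = 1600 * Real.log n := by
  have hn' : (1 : ℝ) ≤ n := by exact_mod_cast hn
  have hlog := Real.log_nonneg hn'
  rw [gammaPar, mul_pow, Real.sq_sqrt (by positivity)]
  field_simp
  norm_num
  ring

theorem kPar_cube_le {n : ℕ} (hk : 1 ≤ kPar n) :
    0 < gammaPar n ∧ (kPar n : ℝ) ^ 3 * gammaPar n ^ 2 ≤ 0.01 := by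
  have hγ : 0 < gammaPar n := by
    rcases (by unfold gammaPar; positivity : (0 : ℝ) ≤ gammaPar n).lt_or_eq with h | h
    · exact h
    · rw [kPar, ← h] at hk
      norm_num [Real.zero_rpow] at hk
  refine ⟨hγ, ?_⟩
  have h1 : (kPar n : ℝ) ≤ (0.1 / gammaPar n) ^ ((2 : ℝ) / 3) := Nat.floor_le (by positivity)
  have h2 : (kPar n : ℝ) ^ 3 ≤ (0.1 / gammaPar n) ^ 2 := by
    calc (kPar n : ℝ) ^ 3 ≤ ((0.1 / gammaPar n) ^ ((2 : ℝ) / 3)) ^ 3 := by gcongr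
      _ = (0.1 / gammaPar n) ^ 2 := by
        rw [← Real.rpow_natCast, ← Real.rpow_mul (by positivity), ← Real.rpow_natCast]
        norm_num
  rw [div_pow, le_div_iff₀ (by positivity)] at h2
  norm_num at h2 ⊢
  exact h2

/-- The numerical relations between the parameters that the lower bound rests on. -/
theorem param_bounds {n : ℕ} (hk : 1 ≤ kPar n) :
    0 < gammaPar n ∧ 8 ≤ Real.log n ∧ 2 * kPar n ≤ n ∧
      (kPar n : ℝ) * gammaPar n ≤ 0.1 / √(kPar n : ℝ) := by
  obtain ⟨hγ, h3⟩ := kPar_cube_le hk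
  have hk1 : (1 : ℝ) ≤ kPar n := by exact_mod_cast hk
  have hn2 : 2 ≤ n := by
    by_contra h
    have h2 : n = 0 ∨ n = 1 := by omega
    rcases h2 with rfl | rfl <;> simp [gammaPar] at hγ
  have hn2' : (2 : ℝ) ≤ n := by exact_mod_cast hn2
  have hlog2 := Real.log_two_gt_d9
  have hlog : (0.69 : ℝ) ≤ Real.log n := by
    have := Real.log_le_log (by norm_num) hn2'
    linarith
  have hγ2 := gammaPar_sq_mul (by omega : 1 ≤ n)
  -- From k³γ² ≤ 0.01 and γ²n = 1600 ln n; already k ≥ 1 forces n to be large.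
  have hmain : (kPar n : ℝ) ^ 3 * (160000 * Real.log n) ≤ n := by
    have h4 := mul_le_mul_of_nonneg_right h3 (by linarith : (0 : ℝ) ≤ n)
    rw [mul_assoc, hγ2] at h4
    linarith
  have hcube : (kPar n : ℝ) ≤ (kPar n : ℝ) ^ 3 := le_self_pow₀ hk1 (by norm_num)
  have hmain2 : (kPar n : ℝ) * (160000 * Real.log n) ≤ n :=
    (mul_le_mul_of_nonneg_right hcube (by linarith)).trans hmain
  refine ⟨hγ, ?_, ?_, ?_⟩
  -- Indeed 160000 · 0.69 > 2^16, and 16 ln 2 > 8.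
  · have h5 : (2 : ℝ) ^ 16 ≤ n := by nlinarith
    have h6 := Real.log_le_log (by norm_num) h5
    rw [Real.log_pow] at h6
    push_cast at h6
    linarith
  · have : (2 : ℝ) * kPar n ≤ n := by nlinarith
    exact_mod_cast this
  · rw [le_div_iff₀ (by positivity)]
    refine le_of_sq_le_sq ?_ (by norm_num)
    rw [mul_pow, mul_pow, Real.sq_sqrt (by positivity)]
    norm_num at h3 ⊢
    linarith

theorem rhoPar_pos {n : ℕ} (p : ℕ) (hγ : 0 < gammaPar n) (hlog : 8 ≤ Real.log n) :
    0 < rhoPar p n := by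
  have : (0 : ℝ) < alphaPar p := by simp only [alphaPar]; positivity
  unfold rhoPar
  positivity

theorem betaPar_pos {n : ℕ} (hγ : 0 < gammaPar n) (hlog : 8 ≤ Real.log n) : 0 < betaPar n := by
  unfold betaPar
  positivity

theorem betaPar_le {n : ℕ} (hγ : 0 < gammaPar n) (hlog : 8 ≤ Real.log n) :
    betaPar n ≤ gammaPar n / 8 := by
  unfold betaPar
  gcongr

theorem one_le_alphaPar (p : ℕ) : (1 : ℝ) ≤ alphaPar p := by
  simp [alphaPar]

/-! ### Softmax -/

theorem smax_sum_pos {k : ℕ} (ρ : ℝ) {m : ℕ} (z : Fin k → ℝ) {l : Fin k} (hl : (l : ℕ) < m) :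
    0 < ∑ i ∈ Finset.univ.filter (fun i : Fin k => (i : ℕ) < m), Real.exp (z i / ρ) :=
  Finset.sum_pos (fun _ _ => Real.exp_pos _) ⟨l, by simp [hl]⟩

theorem smaxLE_le_add {k : ℕ} {ρ : ℝ} (hρ : 0 < ρ) {m : ℕ} {z z' : Fin k → ℝ} {d : ℝ}
    {l : Fin k} (hl : (l : ℕ) < m) (h : ∀ i, z i ≤ z' i + d) :
    smaxLE ρ m z ≤ smaxLE ρ m z' + d := by
  have h1 : ∑ i ∈ Finset.univ.filter (fun i : Fin k => (i : ℕ) < m), Real.exp (z i / ρ)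
      ≤ Real.exp (d / ρ) *
        ∑ i ∈ Finset.univ.filter (fun i : Fin k => (i : ℕ) < m), Real.exp (z' i / ρ) := by
    rw [Finset.mul_sum]
    refine Finset.sum_le_sum fun i _ => ?_
    rw [← Real.exp_add, ← add_div]
    gcongr
    linarith [h i]
  have h2 := Real.log_le_log (smax_sum_pos ρ z hl) h1
  rw [Real.log_mul (Real.exp_pos _).ne' (smax_sum_pos ρ z' hl).ne', Real.log_exp] at h2
  calc smaxLE ρ m z ≤ ρ * (d / ρ + Real.log (∑ i ∈ Finset.univ.filter
        (fun i : Fin k => (i : ℕ) < m), Real.exp (z' i / ρ))) :=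
        mul_le_mul_of_nonneg_left h2 hρ.le
    _ = smaxLE ρ m z' + d := by rw [smaxLE]; field_simp; ring

theorem le_smaxLE {k : ℕ} {ρ : ℝ} (hρ : 0 < ρ) {m : ℕ} (z : Fin k → ℝ) {l : Fin k}
    (hl : (l : ℕ) < m) : z l ≤ smaxLE ρ m z := by
  have h1 : Real.exp (z l / ρ)
      ≤ ∑ i ∈ Finset.univ.filter (fun i : Fin k => (i : ℕ) < m), Real.exp (z i / ρ) :=
    Finset.single_le_sum (f := fun i => Real.exp (z i / ρ)) (fun _ _ => (Real.exp_pos _).le)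
      (by simp [hl])
  have h2 := Real.log_le_log (Real.exp_pos _) h1
  rw [Real.log_exp, div_le_iff₀ hρ, mul_comm] at h2
  exact h2

theorem smaxLE_le {k : ℕ} {ρ : ℝ} (hρ : 0 < ρ) {m : ℕ} {z : Fin k → ℝ} {M : ℝ} {l : Fin k}
    (hl : (l : ℕ) < m) (h : ∀ i, z i ≤ M) : smaxLE ρ m z ≤ M + ρ * Real.log k := by
  have hk : (0 : ℝ) < k := by
    have := l.pos
    exact_mod_cast this
  have h1 : ∑ i ∈ Finset.univ.filter (fun i : Fin k => (i : ℕ) < m), Real.exp (z i / ρ)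
      ≤ k * Real.exp (M / ρ) := by
    calc _ ≤ ∑ i ∈ Finset.univ.filter (fun i : Fin k => (i : ℕ) < m), Real.exp (M / ρ) := by
          refine Finset.sum_le_sum fun i _ => ?_
          gcongr
          exact h i
      _ ≤ ∑ i : Fin k, Real.exp (M / ρ) :=
          Finset.sum_le_sum_of_subset_of_nonneg (Finset.filter_subset _ _)
            fun _ _ _ => (Real.exp_pos _).le
      _ = _ := by simp
  have h2 := Real.log_le_log (smax_sum_pos ρ z hl) h1
  rw [Real.log_mul hk.ne' (Real.exp_pos _).ne', Real.log_exp] at h2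
  calc smaxLE ρ m z ≤ ρ * (Real.log k + M / ρ) := mul_le_mul_of_nonneg_left h2 hρ.le
    _ = _ := by field_simp; ring

/-- Later coordinates that are small enough increase the softmax only slightly. -/
theorem smaxLE_succ_le {k : ℕ} {ρ ν : ℝ} (hρ : 0 < ρ) {z : Fin k → ℝ} {i j : Fin k} (hij : i ≤ j)
    (h : ∀ l : Fin k, i < l → Real.exp (z l / ρ) ≤ Real.exp (z i / ρ) * ν) :
    smaxLE ρ ((j : ℕ) + 1) z ≤ smaxLE ρ ((i : ℕ) + 1) z + ρ * (((j : ℝ) - i) * ν) := by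
  set S := ∑ l ∈ Finset.univ.filter (fun l : Fin k => (l : ℕ) < (i : ℕ) + 1),
    Real.exp (z l / ρ) with hS
  have hS0 : 0 < S := smax_sum_pos ρ z (Nat.lt_succ_self i)
  have hSi : Real.exp (z i / ρ) ≤ S :=
    Finset.single_le_sum (f := fun l => Real.exp (z l / ρ)) (fun _ _ => (Real.exp_pos _).le)
      (by simp)
  -- The equality case is separate because only a strictly later index forces `ν` to be nonnegative.
  rcases hij.eq_or_lt with rfl | hlt
  · simp
  have hν : 0 ≤ ν := by
    have h1 := (Real.exp_pos _).le.trans (h j hlt)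
    exact nonneg_of_mul_nonneg_right h1 (Real.exp_pos _)
  have hsplit : ∑ l ∈ Finset.univ.filter (fun l : Fin k => (l : ℕ) < (j : ℕ) + 1),
      Real.exp (z l / ρ) = S + ∑ l ∈ Finset.Ioc i j, Real.exp (z l / ρ) := by
    rw [hS, ← Finset.sum_union]
    · refine Finset.sum_congr ?_ fun _ _ => rfl
      ext l
      simp only [Finset.mem_filter, Finset.mem_univ, true_and, Finset.mem_union, Finset.mem_Ioc,
        Fin.lt_def, Fin.le_def]
      have : (i : ℕ) < j := hlt
      omega
    · rw [Finset.disjoint_left]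
      intro l hl hl'
      simp only [Finset.mem_filter, Finset.mem_univ, true_and, Finset.mem_Ioc,
        Fin.lt_def, Fin.le_def] at hl hl'
      omega
  have htail : ∑ l ∈ Finset.Ioc i j, Real.exp (z l / ρ) ≤ ((j : ℝ) - i) * (S * ν) := by
    calc ∑ l ∈ Finset.Ioc i j, Real.exp (z l / ρ) ≤ ∑ l ∈ Finset.Ioc i j, S * ν := by
          refine Finset.sum_le_sum fun l hl => (h l (Finset.mem_Ioc.1 hl).1).trans ?_
          gcongr
      _ = _ := by
          rw [Finset.sum_const, Fin.card_Ioc, nsmul_eq_mul, Nat.cast_sub hij]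
  have hle : ∑ l ∈ Finset.univ.filter (fun l : Fin k => (l : ℕ) < (j : ℕ) + 1),
      Real.exp (z l / ρ) ≤ S * Real.exp (((j : ℝ) - i) * ν) := by
    rw [hsplit]
    have h1 := Real.add_one_le_exp (((j : ℝ) - i) * ν)
    calc _ ≤ S * (((j : ℝ) - i) * ν + 1) := by linarith
      _ ≤ _ := by gcongr
  have h2 := Real.log_le_log (smax_sum_pos ρ z (Nat.lt_succ_self j)) hle
  rw [Real.log_mul hS0.ne' (Real.exp_pos _).ne', Real.log_exp] at h2
  calc smaxLE ρ ((j : ℕ) + 1) z ≤ ρ * (Real.log S + ((j : ℝ) - i) * ν) :=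
        mul_le_mul_of_nonneg_left h2 hρ.le
    _ = _ := by rw [smaxLE]; ring

/-! ### The hard functions and their truncations -/

/-- The truncation `max_{j ≤ i} f_j` of `h`. -/
def hPre (p : ℕ) {n k : ℕ} (V : Fin k → E n) (i : Fin k) (x : E n) : ℝ :=
  ⨆ j : Fin k, fHard p V (min j i) x

/-- The smoothing of `max_{j ≤ i} f_j`. -/
def gPre (p : ℕ) {n k : ℕ} (V : Fin k → E n) (i : Fin k) : E n → ℝ :=
  smoothing (betaPar n) p (hPre p V i)

theorem fHard_le_hHard {p n k : ℕ} (V : Fin k → E n) (i : Fin k) (x : E n) :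
    fHard p V i x ≤ hHard p V x :=
  le_ciSup (f := fun i => fHard p V i x) (Set.finite_range _).bddAbove i

theorem fHard_congr {p n k : ℕ} {V V' : Fin k → E n} {i : Fin k}
    (h : ∀ l : Fin k, l ≤ i → V l = V' l) (x : E n) : fHard p V i x = fHard p V' i x := by
  unfold fHard smaxLE
  congr 3
  refine Finset.sum_congr rfl fun l hl => ?_
  simp only [Finset.mem_filter, Finset.mem_univ, true_and] at hl
  rw [vecV, vecV, h l (Fin.le_def.2 (by omega))]

theorem gPre_congr {p n k : ℕ} {V V' : Fin k → E n} {i : Fin k}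
    (h : ∀ l : Fin k, l ≤ i → V l = V' l) : gPre p V i = gPre p V' i := by
  unfold gPre
  congr 1
  funext x
  unfold hPre
  congr 1
  funext j
  exact fHard_congr (fun l hl => h l (hl.trans (min_le_right _ _))) x

/-- The crude constant works for every tuple: measurability in `V` requires smoothness also at
frames that are not orthonormal. -/
theorem fHard_lipschitz {p n k : ℕ} (hρ : 0 < rhoPar p n) (V : Fin k → E n) (i : Fin k) (x y : E n) :
    fHard p V i x ≤ fHard p V i y + (∑ l, ‖V l‖) * dist x y := by
  have h := smaxLE_le_add hρ (m := (i : ℕ) + 1) (z := vecV (gammaPar n) V x)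
    (z' := vecV (gammaPar n) V y) (d := (∑ l, ‖V l‖) * dist x y) (Nat.lt_succ_self i) fun l => by
      have h1 : inner ℝ (V l) x = inner ℝ (V l) y + inner ℝ (V l) (x - y) := by
        rw [← inner_add_right]; simp
      have h2 := real_inner_le_norm (V l) (x - y)
      have h3 : ‖V l‖ ≤ ∑ l, ‖V l‖ :=
        Finset.single_le_sum (f := fun l => ‖V l‖) (fun _ _ => norm_nonneg _) (Finset.mem_univ l)
      rw [← dist_eq_norm] at h2
      have h4 := mul_le_mul_of_nonneg_right h3 (dist_nonneg (x := x) (y := y))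
      simp only [vecV, h1]
      linarith
  unfold fHard
  linarith

theorem lipschitz_iSup {ι : Type*} [Finite ι] [Nonempty ι] {X : Type*} [PseudoMetricSpace X]
    {C : NNReal} {f : ι → X → ℝ} (h : ∀ i x y, f i x ≤ f i y + C * dist x y) :
    LipschitzWith C fun x => ⨆ i, f i x := by
  refine LipschitzWith.of_le_add_mul _ fun x y => ciSup_le fun i => (h i x y).trans ?_
  have := le_ciSup (f := fun i => f i y) (Set.finite_range _).bddAbove i
  linarith

theorem hPre_lipschitz {p n k : ℕ} (hρ : 0 < rhoPar p n) (V : Fin k → E n) (i : Fin k) :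
    LipschitzWith (∑ l, ‖V l‖₊) (hPre p V i) := by
  have : Nonempty (Fin k) := ⟨i⟩
  refine lipschitz_iSup fun j x y => ?_
  have := fHard_lipschitz hρ V (min j i) x y
  push_cast
  exact this

theorem hHard_lipschitz {p n k : ℕ} (hρ : 0 < rhoPar p n) (hk : 1 ≤ k) (V : Fin k → E n) :
    LipschitzWith (∑ l, ‖V l‖₊) (hHard p V) := by
  have : Nonempty (Fin k) := ⟨⟨0, hk⟩⟩
  refine lipschitz_iSup fun j x y => ?_
  have := fHard_lipschitz hρ V j x y
  push_cast
  exact this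

theorem continuous_fHard {p n k : ℕ} (i : Fin k) :
    Continuous fun q : (Fin k → E n) × E n => fHard p q.1 i q.2 := by
  unfold fHard smaxLE
  refine (continuous_const.mul (Continuous.log ?_ fun q =>
    (smax_sum_pos _ _ (Nat.lt_succ_self (i : ℕ))).ne')).add continuous_const
  refine continuous_finsetSum _ fun l _ => Real.continuous_exp.comp ?_
  unfold vecV
  have h : Continuous fun q : (Fin k → E n) × E n => inner ℝ (q.1 l) q.2 :=
    ((continuous_apply l).comp continuous_fst).inner continuous_snd
  exact (h.add continuous_const).div_const _

theorem continuous_hPre {p n k : ℕ} (i : Fin k) :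
    Continuous fun q : (Fin k → E n) × E n => hPre p q.1 i q.2 := by
  have : Nonempty (Fin k) := ⟨i⟩
  have h : (fun q : (Fin k → E n) × E n => hPre p q.1 i q.2)
      = fun q => Finset.univ.sup' Finset.univ_nonempty fun j => fHard p q.1 (min j i) q.2 := by
    funext q
    rw [Finset.sup'_univ_eq_ciSup]
    rfl
  rw [h]
  exact Continuous.finset_sup'_apply _ fun j _ => continuous_fHard (min j i)

theorem measurable_oracle_gPre {p n k : ℕ} (hρ : 0 < rhoPar p n) (hβ : 0 ≤ betaPar n)
    (i : Fin k) :
    Measurable fun q : (Fin k → E n) × E n => oracle p (gPre p q.1 i) q.2 :=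
  measurable_oracle (g := fun V => gPre p V i)
    (continuous_smoothing_param _ p (f := fun V => hPre p V i) (continuous_hPre i)).measurable
    fun V => (iterLip_smoothing hβ (hPre_lipschitz hρ V i) p).contDiff

/-! ### Locality of the oracle -/

theorem abs_inner_sub_le {n : ℕ} {v x y : E n} (hv : ‖v‖ = 1) {β : ℝ}
    (hy : y ∈ Metric.closedBall x β) : |inner ℝ v y - inner ℝ v x| ≤ β := by
  rw [← inner_sub_right]
  refine (abs_real_inner_le_norm _ _).trans ?_
  rwa [hv, one_mul, ← dist_eq_norm]

theorem fHard_le_fHard {p n k : ℕ} (hγ : 0 < gammaPar n) (hlog : 8 ≤ Real.log n)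
    {V : Fin k → E n} {i j : Fin k} (hij : i ≤ j) {y : E n}
    (h : ∀ l : Fin k, i ≤ l → |inner ℝ (V l) y| ≤ 3 * gammaPar n / 8) :
    fHard p V j y ≤ fHard p V i y := by
  have hρ := rhoPar_pos p hγ hlog
  have hα := one_le_alphaPar p
  have hn : (0 : ℝ) < n := by
    by_contra h0
    have : (n : ℝ) = 0 := le_antisymm (not_lt.1 h0) (Nat.cast_nonneg n)
    rw [this, Real.log_zero] at hlog
    linarith
  have key := smaxLE_succ_le hρ (z := vecV (gammaPar n) V y) (ν := ((n : ℝ) ^ alphaPar p)⁻¹) hij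
    fun l hl => by
      have h1 := abs_le.1 (h i le_rfl)
      have h2 := abs_le.1 (h l hl.le)
      have hli : ((i : ℕ) : ℝ) + 1 ≤ l := by
        have : (i : ℕ) < l := hl
        exact_mod_cast this
      -- The offsets differ by at least γ, and the two inner products cost at most 2 · 3γ/8.
      have h3 : vecV (gammaPar n) V y l ≤ vecV (gammaPar n) V y i - gammaPar n / 4 := by
        simp only [vecV]
        nlinarith
      have h4 : ((n : ℝ) ^ alphaPar p)⁻¹ = Real.exp (-(alphaPar p * Real.log n)) := by
        rw [Real.exp_neg, ← Real.log_pow, Real.exp_log (by positivity)]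
      rw [h4, ← Real.exp_add, Real.exp_le_exp]
      -- The gap divided by ρ is 25 α ln n, far more than the α ln n needed for the ratio n^{-α}.
      have h5 : gammaPar n / 4 = rhoPar p n * (25 * (alphaPar p * Real.log n)) := by
        unfold rhoPar
        field_simp
        norm_num
      have h6 : vecV (gammaPar n) V y l / rhoPar p n
          ≤ (vecV (gammaPar n) V y i - gammaPar n / 4) / rhoPar p n := by gcongr
      rw [sub_div, h5, mul_div_cancel_left₀ _ hρ.ne'] at h6
      have h7 : 0 ≤ alphaPar p * Real.log n := by positivity
      linarith
  -- The error ρ(j-i)n^{-α} cancels exactly against the difference of the two bonuses.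
  unfold fHard
  linarith

/-- If the vectors from `v_i` on are nearly orthogonal to `x`, then the oracle of `g` at `x` only
depends on `v_1, …, v_i`. -/
theorem oracle_gHard_eq {p n k : ℕ} (hγ : 0 < gammaPar n) (hlog : 8 ≤ Real.log n)
    {V : Fin k → E n} (hV : Orthonormal ℝ V) {i : Fin k} {x : E n}
    (h : ∀ l : Fin k, i ≤ l → |inner ℝ (V l) x| ≤ gammaPar n / 4) :
    oracle p (gHard p V) x = oracle p (gPre p V i) x := by
  have : Nonempty (Fin k) := ⟨i⟩
  refine oracle_smoothing_congr (betaPar_pos hγ hlog) p p fun y hy => ?_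
  have hy' : ∀ l : Fin k, i ≤ l → |inner ℝ (V l) y| ≤ 3 * gammaPar n / 8 := by
    intro l hl
    have h1 := abs_le.1 (h l hl)
    have h2 := abs_le.1 (abs_inner_sub_le (hV.1 l) hy)
    have h3 := betaPar_le hγ hlog
    rw [abs_le]
    constructor <;> linarith
  refine le_antisymm ?_ (ciSup_le fun j => fHard_le_hHard V (min j i) y)
  refine ciSup_mono (Set.finite_range _).bddAbove fun j => ?_
  rcases le_total j i with hj | hj
  · rw [min_eq_left hj]
  · rw [min_eq_right hj]
    exact fHard_le_fHard hγ hlog hj hy'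

/-! ### Points nearly orthogonal to the last vector are not optimal -/

theorem norm_sum_orthonormal {n k : ℕ} {V : Fin k → E n} (hV : Orthonormal ℝ V) :
    ‖∑ l, V l‖ ^ 2 = k := by
  rw [← real_inner_self_eq_norm_sq]
  simpa using hV.inner_sum (fun _ => (1 : ℝ)) (fun _ => (1 : ℝ)) Finset.univ

theorem not_isApproxMin {p n : ℕ} (hk : 1 ≤ kPar n) {V : Fin (kPar n) → E n}
    (hV : Orthonormal ℝ V) {l : Fin (kPar n)} (hl : (l : ℕ) + 1 = kPar n) {x : E n}
    (hx : |inner ℝ (V l) x| ≤ gammaPar n / 4) : ¬ IsApproxMin (epsPar n) (gHard p V) x := by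
  rintro ⟨-, hmin⟩
  obtain ⟨hγ, hlog, hkn, hkγ⟩ := param_bounds hk
  have hρ := rhoPar_pos p hγ hlog
  have hβ := betaPar_pos hγ hlog
  have hβγ := betaPar_le hγ hlog
  have hα := one_le_alphaPar p
  have : Nonempty (Fin (kPar n)) := ⟨l⟩
  have hk1 : (1 : ℝ) ≤ kPar n := by exact_mod_cast hk
  have hn1 : (1 : ℝ) ≤ n := by
    have : 1 ≤ n := by omega
    exact_mod_cast this
  have hkn' : (kPar n : ℝ) ≤ n := by exact_mod_cast kPar_le n
  have hcont : Continuous (hHard p V) := (hHard_lipschitz hρ hk V).continuous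
  have hball : ∀ {u y : E n}, y ∈ Metric.closedBall u (betaPar n * (1 - (1 / 2) ^ p)) →
      y ∈ Metric.closedBall u (betaPar n) := by
    intro u y hy
    refine Metric.closedBall_subset_closedBall ?_ hy
    have : (0 : ℝ) < (1 / 2) ^ p := by positivity
    nlinarith
  have hlow : -(gammaPar n / 4) - betaPar n ≤ gHard p V x := by
    refine le_smoothing hβ p hcont fun y hy => le_trans ?_ (fHard_le_hHard V l y)
    have h1 := abs_le.1 (abs_inner_sub_le (hV.1 l) (hball hy))
    have h2 := abs_le.1 hx
    have h3 := le_smaxLE hρ (vecV (gammaPar n) V y) (Nat.lt_succ_self (l : ℕ))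
    -- The last coordinate carries neither an offset nor a bonus.
    have h4 : (kPar n : ℝ) - ((l : ℝ) + 1) = 0 := by
      rw [sub_eq_zero]
      exact_mod_cast hl.symm
    have h5 : vecV (gammaPar n) V y l = inner ℝ (V l) y := by
      simp only [vecV, h4, zero_mul, add_zero]
    rw [h5] at h3
    unfold fHard
    rw [h4]
    simp only [mul_zero, zero_mul, add_zero]
    exact le_trans (by linarith) h3
  set s := √(kPar n : ℝ) with hs
  have hs0 : 0 < s := Real.sqrt_pos.2 (by linarith)
  have hs2 : s ^ 2 = kPar n := Real.sq_sqrt (by linarith)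
  -- The unit vector whose inner product with every v_l is -1/√k.
  set y₀ : E n := (-(1 / s)) • ∑ l, V l with hy₀
  have hy₀norm : ‖y₀‖ ≤ 1 := by
    have h1 : ‖y₀‖ ^ 2 = 1 := by
      rw [hy₀, norm_smul, mul_pow, norm_sum_orthonormal hV, ← hs2]
      simp only [norm_neg, Real.norm_eq_abs, sq_abs]
      field_simp
    nlinarith [norm_nonneg y₀]
  have hy₀inner : ∀ i, inner ℝ (V i) y₀ = -(1 / s) := by
    intro i
    have h1 := hV.inner_right_fintype (fun _ => (1 : ℝ)) i
    simp only [one_smul] at h1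
    rw [hy₀, inner_smul_right, h1, mul_one]
  set M := -(1 / s) + betaPar n + ((kPar n : ℝ) - 1) * gammaPar n with hM
  have hup : gHard p V y₀ ≤ M + rhoPar p n * Real.log (kPar n) + rhoPar p n := by
    refine smoothing_le hβ p hcont fun z hz => ciSup_le fun i => ?_
    have h1 : ∀ j, vecV (gammaPar n) V z j ≤ M := by
      intro j
      have h2 := abs_le.1 (abs_inner_sub_le (hV.1 j) (hball hz))
      rw [hy₀inner] at h2
      have h3 : (0 : ℝ) ≤ (j : ℝ) := Nat.cast_nonneg _
      simp only [vecV]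
      nlinarith
    have h2 := smaxLE_le hρ (Nat.lt_succ_self (i : ℕ)) h1
    have h3 : ((kPar n : ℝ) - ((i : ℝ) + 1)) * ((n : ℝ) ^ alphaPar p)⁻¹ ≤ 1 := by
      rw [← div_eq_mul_inv, div_le_one (by positivity)]
      have h4 : (n : ℝ) ≤ (n : ℝ) ^ alphaPar p := le_self_pow₀ hn1 (by simp [alphaPar])
      have h5 : (0 : ℝ) ≤ (i : ℝ) := Nat.cast_nonneg _
      linarith
    have h4 := mul_le_mul_of_nonneg_left h3 hρ.le
    unfold fHard
    nlinarith
  have hgap := hmin y₀ hy₀norm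
  have hlogk : Real.log (kPar n) ≤ Real.log n := Real.log_le_log (by linarith) hkn'
  have hρlog : rhoPar p n * Real.log n ≤ gammaPar n / 100 := by
    have h1 : rhoPar p n * Real.log n = gammaPar n / (100 * alphaPar p) := by
      unfold rhoPar
      field_simp
    rw [h1]
    gcongr
    linarith
  have hρ1 : rhoPar p n * Real.log (kPar n) + rhoPar p n ≤ gammaPar n / 50 := by
    have h1 := mul_le_mul_of_nonneg_left hlogk hρ.le
    have h2 : rhoPar p n ≤ rhoPar p n * Real.log n := le_mul_of_one_le_right hρ.le (by linarith)
    linarith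
  have heps : epsPar n = 0.1 * (1 / s) := by rw [epsPar]; ring
  have hkγ' : (kPar n : ℝ) * gammaPar n ≤ 0.1 * (1 / s) := by
    refine hkγ.trans (le_of_eq ?_)
    ring
  have hs1 : 0 < 1 / s := by positivity
  rw [heps] at hgap
  -- The main gap 1/√k - kγ is at least 0.9/√k > ε, and the spare γ absorbs the errors γ/4 + 2β +
  -- γ/50, because 2β ≤ γ/4.
  have hM' : M = -(1 / s) + betaPar n + (kPar n * gammaPar n - gammaPar n) := by rw [hM]; ring
  linarith

/-! ### The run with truncated answers -/

/-- The point that a move queries or outputs. -/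
def movePoint {n : ℕ} : E n ⊕ E n → E n := Sum.elim id id

theorem measurable_movePoint {n : ℕ} : Measurable (movePoint (n := n)) :=
  measurable_id.sumElim measurable_id

/-- The first `i` answers if the `j`-th query is answered according to the truncation of `g` that
depends on `v_1, …, v_j` only. -/
def hypAnswers {n p k : ℕ} {Ω : Type*} [MeasurableSpace Ω] (A : RandAlg n p Ω)
    (ω : Ω) (V : Fin k → E n) : (i : ℕ) → (Fin i → Answer n p)
  | 0 => Fin.elim0
  | i + 1 => Fin.snoc (α := fun _ => Answer n p) (hypAnswers A ω V i)
      -- Querying at an output point and the default answer 0 from index k on only make the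
      -- recursion total; the comparison with the actual run uses neither.
      (if h : i < k then
        oracle p (gPre p V ⟨i, h⟩) (movePoint (A.next i ω (hypAnswers A ω V i)))
      else 0)

/-- The point queried or output after `i` such answers. -/
def hypPoint {n p k : ℕ} {Ω : Type*} [MeasurableSpace Ω] (A : RandAlg n p Ω)
    (i : ℕ) (ω : Ω) (V : Fin k → E n) : E n :=
  movePoint (A.next i ω (hypAnswers A ω V i))

theorem measurable_hypPoint_of_answers {n p k : ℕ} {Ω : Type*} [MeasurableSpace Ω]
    (A : RandAlg n p Ω) (i : ℕ)
    (h : Measurable fun q : Ω × (Fin k → E n) => hypAnswers A q.1 q.2 i) :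
    Measurable fun q : Ω × (Fin k → E n) => hypPoint A i q.1 q.2 :=
  measurable_movePoint.comp ((A.measurable_next i).comp (measurable_fst.prodMk h))

theorem measurable_hypAnswers {n p k : ℕ} {Ω : Type*} [MeasurableSpace Ω] (A : RandAlg n p Ω)
    (hρ : 0 < rhoPar p n) (hβ : 0 ≤ betaPar n) (i : ℕ) :
    Measurable fun q : Ω × (Fin k → E n) => hypAnswers A q.1 q.2 i := by
  induction i with
  | zero => exact measurable_pi_lambda _ fun j => j.elim0
  | succ i ih =>
    refine measurable_pi_iff.2 fun j => ?_
    induction j using Fin.lastCases with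
    | last =>
      simp only [hypAnswers, Fin.snoc_last]
      by_cases h : i < k
      · have h1 := (measurable_oracle_gPre hρ hβ ⟨i, h⟩).comp
          (measurable_snd.prodMk (measurable_hypPoint_of_answers A i ih))
        simp only [h, dite_true]
        exact h1
      · simp only [h, dite_false]
        exact measurable_const
    | cast j =>
      simp only [hypAnswers, Fin.snoc_castSucc]
      exact measurable_pi_iff.1 ih j

theorem measurable_hypPoint {n p k : ℕ} {Ω : Type*} [MeasurableSpace Ω] (A : RandAlg n p Ω)
    (hρ : 0 < rhoPar p n) (hβ : 0 ≤ betaPar n) (i : ℕ) :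
    Measurable fun q : Ω × (Fin k → E n) => hypPoint A i q.1 q.2 :=
  measurable_hypPoint_of_answers A i (measurable_hypAnswers A hρ hβ i)

/-- The last of `i` answers comes from `gPre` with zero-based index i-1, which sees precisely the
vectors of index below `i`. -/
theorem hypAnswers_congr {n p k : ℕ} {Ω : Type*} [MeasurableSpace Ω] (A : RandAlg n p Ω)
    (ω : Ω) {V V' : Fin k → E n} (i : ℕ) (h : ∀ b : Fin k, (b : ℕ) < i → V b = V' b) :
    hypAnswers A ω V i = hypAnswers A ω V' i := by
  induction i with
  | zero => rfl
  | succ i ih =>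
    have h1 := ih fun b hb => h b (by omega)
    simp only [hypAnswers]
    rw [h1]
    by_cases hi : i < k
    · have h2 : gPre p V ⟨i, hi⟩ = gPre p V' ⟨i, hi⟩ :=
        gPre_congr fun l hl => h l (Nat.lt_succ_of_le hl)
      simp only [hi, dif_pos, h2]
    · simp only [hi, dif_neg, not_false_eq_true]

/-- Unless some point of the truncated run has a large inner product with one of the vectors that
it does not depend on, the actual run coincides with the truncated one and fails. -/
theorem runFrom_not_isApproxMin {n p : ℕ} {Ω : Type*} [MeasurableSpace Ω] (A : RandAlg n p Ω)
    (hk : 1 ≤ kPar n) {V : Fin (kPar n) → E n} (hV : Orthonormal ℝ V) {ω : Ω}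
    (hgood : ∀ i l : Fin (kPar n), i ≤ l → ‖hypPoint A i ω V‖ ≤ 1 →
      |inner ℝ (V l) (hypPoint A i ω V)| ≤ gammaPar n / 4)
    (m i : ℕ) (him : i + m + 1 = kPar n) (x : E n)
    (hx : A.runFrom (oracle p (gHard p V)) ω m i (hypAnswers A ω V i) = some x) :
    ¬ IsApproxMin (epsPar n) (gHard p V) x := by
  have hout : ∀ i : ℕ, i < kPar n → A.next i ω (hypAnswers A ω V i) = Sum.inr x →
      ¬ IsApproxMin (epsPar n) (gHard p V) x := by
    intro i hi hnext hmin
    have h1 : hypPoint A i ω V = x := by simp [hypPoint, hnext, movePoint]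
    -- With at most k-1 answers received, the last vector is still one that the output point does
    -- not depend on.
    have h2 := hgood ⟨i, hi⟩ ⟨kPar n - 1, by omega⟩ (Fin.le_def.2 (by simp; omega))
    simp only [h1] at h2
    exact not_isApproxMin hk hV (by simp; omega) (h2 hmin.1) hmin
  induction m generalizing i with
  | zero =>
    rw [RandAlg.runFrom] at hx
    split at hx
    · simp at hx
    · rename_i y hy
      rw [Option.some.injEq] at hx
      exact hout i (by omega) (hx ▸ hy)
  | succ m ih =>
    rw [RandAlg.runFrom] at hx
    split at hx
    · rename_i y hy
      have hi : i < kPar n := by omega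
      refine ih (i + 1) (by omega) ?_
      rw [← hx, hypAnswers]
      have h1 : hypPoint A i ω V = y := by simp [hypPoint, hy, movePoint]
      have h2 : oracle p (gHard p V) y = oracle p (gPre p V ⟨i, hi⟩) y := by
        obtain ⟨hγ, hlog, -⟩ := param_bounds hk
        refine oracle_gHard_eq hγ hlog hV fun l hl => ?_
        have h3 := hgood ⟨i, hi⟩ l hl
        simp only [h1] at h3
        exact h3 (A.query_mem i ω _ y hy)
      simp only [hi, dif_pos, hy, movePoint, Sum.elim_inl, id, h2]
    · rename_i y hy
      rw [Option.some.injEq] at hx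
      exact hout i (by omega) (hx ▸ hy)

/-! ### The success probability -/

/-- As n - i ≥ n/2, the exponent is at least γ²n/64 = 25 ln n. -/
theorem tail_le {n i : ℕ} (hk : 1 ≤ kPar n) (hi : i < kPar n) :
    2 * Real.exp (-(((n : ℝ) - i) * (gammaPar n / 4) ^ 2) / 2) ≤ 2 * ((n : ℝ) ^ 25)⁻¹ := by
  obtain ⟨hγ, hlog, hkn, -⟩ := param_bounds hk
  have hn : 1 ≤ n := by omega
  have hn' : (0 : ℝ) < n := by exact_mod_cast hn
  have h1 := gammaPar_sq_mul hn
  have h2 : (i : ℝ) ≤ n / 2 := by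
    have : 2 * i ≤ n := by omega
    have : (2 : ℝ) * i ≤ n := by exact_mod_cast this
    linarith
  have h3 : ((n : ℝ) ^ 25)⁻¹ = Real.exp (-(25 * Real.log n)) := by
    rw [Real.exp_neg]
    have := Real.log_pow (n : ℝ) 25
    push_cast at this
    rw [← this, Real.exp_log (by positivity)]
  rw [h3]
  gcongr
  have h4 := mul_le_mul_of_nonneg_right h2 (sq_nonneg (gammaPar n))
  nlinarith

/-- The event that the `i`-th point of the truncated run has a large inner product with the vector
`v_l`, `i ≤ l`. -/
def badEvent {n p k : ℕ} {Ω : Type*} [MeasurableSpace Ω] (A : RandAlg n p Ω)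
    (r : Fin k × Fin k) : Set (Ω × (Fin k → E n)) :=
  {q | r.1 ≤ r.2 ∧ ‖hypPoint A r.1 q.1 q.2‖ ≤ 1 ∧
    gammaPar n / 4 < |inner ℝ (q.2 r.2) (hypPoint A r.1 q.1 q.2)|}

theorem measure_badEvent_le {n p : ℕ} {Ω : Type*} [MeasurableSpace Ω] (μ : Measure Ω)
    [IsProbabilityMeasure μ] (A : RandAlg n p Ω) (hk : 1 ≤ kPar n)
    (r : Fin (kPar n) × Fin (kPar n)) :
    (μ.prod (haarFrame (kPar_le n))) (badEvent A r) ≤ ENNReal.ofReal (2 * ((n : ℝ) ^ 25)⁻¹) := by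
  obtain ⟨hγ, hlog, -⟩ := param_bounds hk
  by_cases hr : r.1 ≤ r.2
  · have hX := measurable_hypPoint (k := kPar n) A (rhoPar_pos p hγ hlog)
      (betaPar_pos hγ hlog).le (r.1 : ℕ)
    have hset : badEvent A r = {q : Ω × (Fin (kPar n) → E n) | ‖hypPoint A r.1 q.1 q.2‖ ≤ 1 ∧
        gammaPar n / 4 < |inner ℝ (q.2 r.2) (hypPoint A r.1 q.1 q.2)|} := by
      ext q
      exact ⟨fun h => h.2, fun h => ⟨hr, h⟩⟩
    have hmeas := measurableSet_large_inner hX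
      (Y := fun q : Ω × (Fin (kPar n) → E n) => q.2 r.2)
      ((measurable_pi_apply r.2).comp measurable_snd) (gammaPar n / 4)
    rw [hset, Measure.prod_apply hmeas]
    calc _ ≤ ∫⁻ _, ENNReal.ofReal (2 * ((n : ℝ) ^ 25)⁻¹) ∂μ := by
          -- The seed is independent of the frame, so it can be frozen; the point is then a function
          -- of the first vectors alone.
          refine lintegral_mono fun ω => ?_
          refine (haarFrame_tail (kPar_le n) (i := (r.1 : ℕ)) (l := r.2) hr
            (X := fun V => hypPoint A r.1 ω V) (hX.comp measurable_prodMk_left)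
            (fun V V' h => ?_) (t := gammaPar n / 4) (by positivity)).trans
            (ENNReal.ofReal_le_ofReal (tail_le hk r.1.2))
          rw [hypPoint, hypPoint, hypAnswers_congr A ω _ h]
      _ = _ := by simp
  · have hset : badEvent A r = (∅ : Set (Ω × (Fin (kPar n) → E n))) := by
      ext q
      exact ⟨fun h => (hr h.1).elim, fun h => h.elim⟩
    simp [hset]

theorem successProb_le {n p : ℕ} {Ω : Type*} [MeasurableSpace Ω] (μ : Measure Ω)
    [IsProbabilityMeasure μ] (A : RandAlg n p Ω) (hk : 1 ≤ kPar n) :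
    successProb μ A ≤ ((kPar n : ℝ≥0∞) + 1) / (n : ℝ≥0∞) ^ 10 := by
  obtain ⟨hγ, hlog, hkn, -⟩ := param_bounds hk
  set P := μ.prod (haarFrame (kPar_le n)) with hP
  have hnull : P {q | ¬ Orthonormal ℝ q.2} = 0 :=
    Measure.quasiMeasurePreserving_snd.ae (ae_orthonormal_haarFrame (kPar_le n))
  have hsub : {q : Ω × (Fin (kPar n) → E n) |
      ∃ x, A.output (oracle p (gHard p q.2)) (kPar n - 1) q.1 = some x ∧
        IsApproxMin (epsPar n) (gHard p q.2) x}
      ⊆ (⋃ r : Fin (kPar n) × Fin (kPar n), badEvent A r) ∪ {q | ¬ Orthonormal ℝ q.2} := by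
    rintro ⟨ω, V⟩ ⟨x, hx, hmin⟩
    by_contra hnot
    rw [Set.mem_union, not_or, Set.mem_iUnion, not_exists] at hnot
    obtain ⟨hgood, hV⟩ := hnot
    refine runFrom_not_isApproxMin A hk (not_not.1 hV) (fun i l hil hnorm => ?_) (kPar n - 1) 0
      (by omega) x hx hmin
    by_contra hlt
    exact hgood (i, l) ⟨hil, hnorm, not_le.1 hlt⟩
  have hn : (1 : ℝ) ≤ n := by
    have : 1 ≤ n := by omega
    exact_mod_cast this
  have hk' : (2 : ℝ) * kPar n ≤ n := by exact_mod_cast hkn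
  calc successProb μ A
      ≤ P ((⋃ r : Fin (kPar n) × Fin (kPar n), badEvent A r) ∪ {q | ¬ Orthonormal ℝ q.2}) :=
        -- Monotonicity of the outer measure: the success event itself need not be shown measurable.
        measure_mono hsub
    _ ≤ P (⋃ r : Fin (kPar n) × Fin (kPar n), badEvent A r) := by
        refine (measure_union_le _ _).trans ?_
        rw [hnull, add_zero]
    _ ≤ ∑ r : Fin (kPar n) × Fin (kPar n), P (badEvent A r) := measure_iUnion_fintype_le _ _
    _ ≤ ∑ _r : Fin (kPar n) × Fin (kPar n), ENNReal.ofReal (2 * ((n : ℝ) ^ 25)⁻¹) :=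
        Finset.sum_le_sum fun r _ => measure_badEvent_le μ A hk r
    _ = ENNReal.ofReal ((kPar n * kPar n : ℕ) * (2 * ((n : ℝ) ^ 25)⁻¹)) := by
        rw [Finset.sum_const, Finset.card_univ, Fintype.card_prod, Fintype.card_fin,
          ENNReal.ofReal_mul (Nat.cast_nonneg _), ENNReal.ofReal_natCast, nsmul_eq_mul]
    _ ≤ ENNReal.ofReal (((kPar n : ℝ) + 1) / (n : ℝ) ^ 10) := by
        refine ENNReal.ofReal_le_ofReal ?_
        have h1 : (n : ℝ) * n ^ 10 ≤ n ^ 25 := by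
          rw [← pow_succ']
          exact pow_le_pow_right₀ hn (by norm_num)
        rw [← mul_assoc, ← div_eq_mul_inv, div_le_div_iff₀ (by positivity) (by positivity)]
        push_cast
        calc (kPar n : ℝ) * kPar n * 2 * (n : ℝ) ^ 10
            = kPar n * ((2 * kPar n) * (n : ℝ) ^ 10) := by ring
          _ ≤ kPar n * (n * (n : ℝ) ^ 10) := by gcongr
          _ ≤ (kPar n + 1) * (n : ℝ) ^ 25 := by gcongr; linarith
    _ = _ := by
        rw [ENNReal.ofReal_div_of_pos (by positivity), ENNReal.ofReal_add (by positivity) one_pos.le,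
          ENNReal.ofReal_natCast, ENNReal.ofReal_one, ENNReal.ofReal_pow (by positivity),
          ENNReal.ofReal_natCast]

theorem tendsto_gammaPar : Tendsto gammaPar atTop (𝓝 0) := by
  have h1 : Tendsto (fun n : ℕ => Real.log n / n) atTop (𝓝 0) :=
    (Real.isLittleO_log_id_atTop.tendsto_div_nhds_zero).comp tendsto_natCast_atTop_atTop
  have h2 := ((Real.continuous_sqrt.tendsto 0).comp h1).const_mul 40
  rw [Real.sqrt_zero, mul_zero] at h2
  exact h2

theorem eventually_one_le_kPar : ∀ᶠ n in atTop, 1 ≤ kPar n := by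
  filter_upwards [tendsto_gammaPar.eventually_le_const (u := (0.1 : ℝ)) (by norm_num),
    eventually_ge_atTop 2] with n hγ hn
  have hn' : (1 : ℝ) < n := by exact_mod_cast hn
  have hlog := Real.log_pos hn'
  have hγ0 : 0 < gammaPar n := by unfold gammaPar; positivity
  refine Nat.le_floor ?_
  rw [Nat.cast_one]
  exact Real.one_le_rpow ((one_le_div hγ0).2 hγ) (by norm_num)

theorem eventually_bound_le {δ : ℝ≥0∞} (hδ : 0 < δ) :
    ∀ᶠ n in atTop, ((kPar n : ℝ≥0∞) + 1) / (n : ℝ≥0∞) ^ 10 ≤ δ := by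
  filter_upwards [ENNReal.tendsto_inv_nat_nhds_zero.eventually_le_const hδ,
    eventually_ge_atTop 2] with n hn hn2
  refine le_trans ?_ hn
  have hn0 : (n : ℝ≥0∞) ≠ 0 := by
    have : n ≠ 0 := by omega
    exact_mod_cast this
  have hntop : (n : ℝ≥0∞) ≠ ∞ := ENNReal.natCast_ne_top n
  -- Since k ≤ n, the crude estimate n + 1 ≤ n² ≤ n^9 already brings the bound below 1/n.
  have h1 : kPar n + 1 ≤ n ^ 9 := by
    have h2 := kPar_le n
    have h3 : n ^ 2 ≤ n ^ 9 := Nat.pow_le_pow_right (by omega) (by norm_num)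
    nlinarith
  have h2 : (kPar n : ℝ≥0∞) + 1 ≤ (n : ℝ≥0∞) ^ 9 := by exact_mod_cast h1
  rw [ENNReal.div_le_iff (pow_ne_zero _ hn0) (ENNReal.pow_ne_top hntop), pow_succ', ← mul_assoc,
    ENNReal.inv_mul_cancel hn0 hntop, one_mul]
  exact h2

end SmoothConvexLB

end

theorem mainTheorem3 (p : ℕ) (hp : 1 ≤ p) :
    (∀ δ : ℝ≥0∞, 0 < δ → ∀ᶠ n : ℕ in atTop,
      ∀ (Ω : Type*) [MeasurableSpace Ω] (μ : Measure Ω) [IsProbabilityMeasure μ]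
        (A : RandAlg n p Ω), successProb μ A ≤ δ) ∧
    (∀ n : ℕ, 1 ≤ kPar n →
      ∀ (Ω : Type*) [MeasurableSpace Ω] (μ : Measure Ω) [IsProbabilityMeasure μ]
        (A : RandAlg n p Ω),
        successProb μ A ≤ ((kPar n : ℝ≥0∞) + 1) / (n : ℝ≥0∞) ^ 10) := by
  refine ⟨fun δ hδ => ?_, fun n hk Ω _ μ _ A => successProb_le μ A hk⟩
  filter_upwards [eventually_one_le_kPar, eventually_bound_le hδ] with n hk hn Ω _ μ _ A
  exact (successProb_le μ A hk).trans hn
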